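/- **Setting.** Let $(X,d)$ be a metric space. For $\delta>0$ and $C\ge 1$ say that $X$ is $(C,\delta)$-doubling if for all $0<\epsilon\le 1$ and $r>0$ every ball of radius $r$ contains at most $C\epsilon^{-\delta}$ points of mutual distance at least $\epsilon r$; the doubling dimension $m$ of $X$ is the infimum of all $\delta>0$ for which $X$ is $(C,\delta)$-doubling for some $C$. A link $i$ is a pair of distinct points $s_i,r_i\in X$ (sender, receiver), of length $l_i=d(s_i,r_i)$; $d(i,j)$ is the minimum distance between an endpoint of $i$ and an endpoint of $j$, and $d_{ji}=d(s_j,r_i)$. For a finite nonempty set $L$ of links, $\Delta(L)$ is the ratio of the longest to the shortest link length in $L$. Fix $\alpha\in(2,6)$, $\beta>0$ and $N\ge 0$. A finite set $S$ of links is feasible if there are powers $P(i)>0$, $i\in S$, with $$\frac{P(i)}{l_i^\alpha}\ \ge\ \beta\Big(\sum_{j\in S\setminus\{i\}}\frac{P(j)}{d_{ji}^\alpha}+N\Big)\qquad\text{for all } i\in S$$ (where $P(j)/0=\infty$). $OPTS(L)$ is the least number of feasible sets into which $L$ can be partitioned. For a function $f$ let $$B_f(L)=\max_{i\in L}\big|\{j\in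 L:\ l_j\ge l_i,\ d(i,j)\le l_i f(l_j/l_i)\}\big| ,$$ let $B_\gamma$ be $B_f$ for the constant function $f\equiv\gamma$, and, for $x\ge 1$, let $\widetilde{\log}(x)=\max\big((\log_2x)^{2/(\alpha-m)},1\big)$. Finally $\log^*x$ is $1$ for $x\le 2$ and, for $x>2$, the least $c\ge 1$ for which the $c$-fold iterate of $\log_2$ at $x$ is at most $2$. **Theorem.** Let $\alpha\in(2,6)$, $\beta>0$, $m<\alpha$, and let a constant $C_\delta$ be given for each $\delta>m$. There are constants $a,b,K,c>0$ and $\gamma\ge 1$, depending only on these data, such that for every metric space $X$ of doubling dimension $m$ that is $(C_\delta,\delta)$-doubling for all $\delta>m$, and every $N\ge 0$, the following hold. 1. For every finite nonempty set $L$ of links in $X$, $$a\,B_\gamma(L)\le OPTS(L)\le b\,B_{\widetilde{\log}}(L)\qquad\text{and}\qquad \frac{B_{\widetilde{\log}}(L)}{B_\gamma(L)}\le K\log^*\Delta(L).$$ 2. Both gaps are tight: if $X$ contains an isometric copy of the real line (for example $X=\mathbb R$, or a Euclidean space), then for every $D$ there are finite nonempty sets $L',L''$ of links in $X$, each with pairwise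 distinct link lengths, such that $\Delta(L')\ge D$, $\Delta(L'')\ge D$, $$\frac{OPTS(L')}{B_\gamma(L')}\ge c\,\log^*\Delta(L')\qquad\text{and}\qquad\frac{B_{\widetilde{\log}}(L'')}{OPTS(L'')}\ge c\,\log^*\Delta(L'').$$ In particular there are infinitely many such instances $L'$ and $L''$. -/

import Mathlib

namespace SINR

noncomputable section

/-- `C * ε ^ (-δ)` bounds the number of points of mutual distance at least `ε * r` in any ball of
radius `r > 0`, for every `0 < ε ≤ 1`. -/
def IsDoublingWith (X : Type*) [MetricSpace X] (C δ : ℝ) : Prop :=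
  ∀ ε : ℝ, 0 < ε → ε ≤ 1 → ∀ (x : X) (r : ℝ), 0 < r → ∀ S : Finset X,
    (∀ p ∈ S, dist p x ≤ r) → (∀ p ∈ S, ∀ q ∈ S, p ≠ q → ε * r ≤ dist p q) →
      (S.card : ℝ) ≤ C * ε ^ (-δ)

/-- The doubling dimension of a metric space (meaningful when the set below is nonempty, that is,
when the space is doubling). -/
def doublingDim (X : Type*) [MetricSpace X] : ℝ :=
  sInf {δ : ℝ | 0 < δ ∧ ∃ C : ℝ, 1 ≤ C ∧ IsDoublingWith X C δ}

/-- A communication link: a sender and a receiver at different points. -/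
structure Link (X : Type*) where
  sender : X
  receiver : X
  ne : sender ≠ receiver

section Links

variable {X : Type*} [MetricSpace X]

/-- The length of a link. -/
def Link.len (i : Link X) : ℝ := dist i.sender i.receiver

/-- The minimum distance between a node of `i` and a node of `j`. -/
def linkDist (i j : Link X) : ℝ :=
  min (min (dist i.sender j.receiver) (dist j.sender i.receiver))
    (min (dist i.sender j.sender) (dist i.receiver j.receiver))

/-- The ratio between the longest and the shortest link length. -/
def Delta (L : Finset (Link X)) : ℝ :=
  sSup (Link.len '' (L : Set (Link X))) / sInf (Link.len '' (L : Set (Link X)))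

/-- All link lengths in `L` are distinct. -/
def DistinctLengths (L : Finset (Link X)) : Prop :=
  ∀ i ∈ L, ∀ j ∈ L, i.len = j.len → i = j

open Classical in
/-- `S` is feasible: some assignment of positive powers satisfies the SINR condition
at every link of `S`. The interference `P j / 0` of a sender located at the receiver of another
link counts as infinite, so that no such pair is allowed. -/
def Feasible (α β N : ℝ) (S : Finset (Link X)) : Prop :=
  ∃ P : Link X → ℝ, (∀ i ∈ S, 0 < P i) ∧ ∀ i ∈ S,
    (∀ j ∈ S, j ≠ i → 0 < dist j.sender i.receiver) ∧
    β * ((∑ j ∈ S.erase i, P j / dist j.sender i.receiver ^ α) + N) ≤ P i / i.len ^ α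

open Classical in
/-- `L` can be split into `k` feasible slots (a slot may be empty, which does not affect the
minimum number of slots). -/
def Schedulable (α β N : ℝ) (L : Finset (Link X)) (k : ℕ) : Prop :=
  ∃ σ : Link X → ℕ, (∀ i ∈ L, σ i < k) ∧ ∀ c < k, Feasible α β N (L.filter fun i => σ i = c)

/-- The optimum schedule length. -/
def OPTS (α β N : ℝ) (L : Finset (Link X)) : ℕ :=
  sInf {k : ℕ | Schedulable α β N L k}

open Classical in
/-- `B_f(L)`: the maximum over `i ∈ L` of the number of links `j ∈ L` (including `i`) with
`l_j ≥ l_i` and `d(i,j) ≤ l_i f(l_j / l_i)`. -/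
def B (f : ℝ → ℝ) (L : Finset (Link X)) : ℕ :=
  L.sup fun i =>
    (L.filter fun j => i.len ≤ j.len ∧ linkDist i j ≤ i.len * f (j.len / i.len)).card

end Links

/-- `max (log₂ x ^ (2 / (α - m))) 1`, used for `x ≥ 1`. -/
def tlog (α m x : ℝ) : ℝ := max (Real.logb 2 x ^ (2 / (α - m))) 1

/-- The threshold `inf {x ≥ 1 : f x < x} + 1`. -/
def iterThreshold (f : ℝ → ℝ) : ℝ := sInf {x : ℝ | 1 ≤ x ∧ f x < x} + 1

open Classical in
/-- The iterated function `f^*`. -/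
def iterated (f : ℝ → ℝ) (x : ℝ) : ℕ :=
  if iterThreshold f < x then sInf {c : ℕ | 1 ≤ c ∧ f^[c] x ≤ iterThreshold f} else 1

/-- The iterated binary logarithm `log^*`; it is `1` for `x ≤ 2`. -/
def logStar (x : ℝ) : ℕ := iterated (Real.logb 2) x

end

end SINR

/-! Lower bound: a feasible set has only boundedly many links that are at least as long as `i` and
within `γ * i.len` of it. Summing their SINR inequalities against a common weight bounds their
number (`Feasible.card_le`), so every slot meets a neighbourhood counted by `B_γ` in O(1) links.

Upper bound: colouring the links greedily, longest first, splits `L` into `B (tlog α m) L` classes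
that are independent for `tlog`. In such a class the doubling property bounds the total influence `∑
(l_j / d(i,j))^α` of shorter links on any link (`Independent.sum_influence_le`). The class then
splits into `q` sets of small influence, with `q` a constant, and each of these is feasible under
powers defined recursively from the longest link down (`feasible_of_sum_influence_le`).

Gap: cut the range of length ratios at the towers `1, 2, 4, 16, …`, and each interval once more. On
each piece `[y, z]` one has `tlog z ≤ c * y`, so the neighbours of `i` with ratio in the piece all
lie near the shortest of them and are counted by `B_γ` (`B_tlog_le`). There are `O(log* Δ)` pieces.

Tightness of the first gap: a recursive construction on the line gives `γ`-independent sets, so `B_γ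
= 1`, that need `t + 1` slots. One step puts many scaled copies of the previous instance near the
receiver of a long link (`HardInstance.step`). The diameter grows by two exponentials per step, so
`log* Δ = O(t)`.

Tightness of the second gap: a chain of links with tower-growing lengths has bounded total
influence, hence `OPTS = O(1)`, while `tlog` makes every link a neighbour of the shortest one
(`le_B_tlog_towerChainSet`). -/

namespace SINR

/-! ### Towers, iterated logarithms and growth comparisons. -/

/-- The tower function: `tower 0 = 1` and `tower (k + 1) = 2 ^ tower k`. -/
noncomputable def tower : ℕ → ℝ
  | 0 => 1
  | k + 1 => (2 : ℝ) ^ tower k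

theorem tower_succ (k : ℕ) : tower (k + 1) = (2 : ℝ) ^ tower k := rfl

theorem tower_one : tower 1 = 2 := by simp [tower]

theorem add_one_le_two_rpow {x : ℝ} (hx : 1 ≤ x) : x + 1 ≤ (2 : ℝ) ^ x := by
  have := one_add_mul_self_le_rpow_one_add (s := 1) (by norm_num) hx
  norm_num at this
  linarith

theorem one_le_tower (k : ℕ) : 1 ≤ tower k := by
  induction k with
  | zero => exact le_rfl
  | succ k ih => exact Real.one_le_rpow (by norm_num) (by linarith)

theorem tower_pos (k : ℕ) : 0 < tower k := zero_lt_one.trans_le (one_le_tower k)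

theorem tower_add_one_le (k : ℕ) : tower k + 1 ≤ tower (k + 1) :=
  add_one_le_two_rpow (one_le_tower k)

theorem two_mul_tower_le (k : ℕ) : 2 * tower k ≤ tower (k + 1) := by
  induction k with
  | zero => simp [tower]
  | succ k ih =>
    have h : (2 : ℝ) ^ (tower k + 1) ≤ 2 ^ tower (k + 1) :=
      Real.rpow_le_rpow_of_exponent_le (by norm_num) (tower_add_one_le k)
    rw [Real.rpow_add_one (by norm_num)] at h
    rw [tower_succ (k + 1)]
    refine le_trans (le_of_eq ?_) h
    rw [tower_succ k, mul_comm]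

theorem tower_mono : Monotone tower :=
  monotone_nat_of_le_succ fun k => by linarith [tower_add_one_le k]

theorem natCast_add_one_le_tower (k : ℕ) : (k : ℝ) + 1 ≤ tower k := by
  induction k with
  | zero => simp [tower]
  | succ k ih => push_cast; linarith [tower_add_one_le k]

theorem exists_le_tower (x : ℝ) : ∃ k, 1 ≤ k ∧ x ≤ tower k := by
  obtain ⟨k, hk⟩ := exists_nat_ge x
  exact ⟨k + 1, by omega, by
    have := natCast_add_one_le_tower (k + 1)
    push_cast at this
    linarith⟩

theorem iterThreshold_logb : iterThreshold (Real.logb 2) = 2 := by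
  have h : {x : ℝ | 1 ≤ x ∧ Real.logb 2 x < x} = Set.Ici 1 := by
    ext x
    simp only [Set.mem_ofPred_eq, Set.mem_Ici, and_iff_left_iff_imp]
    intro hx
    rw [Real.logb_lt_iff_lt_rpow (by norm_num) (by linarith)]
    linarith [add_one_le_two_rpow hx]
  rw [iterThreshold, h, csInf_Ici]
  norm_num

theorem exists_iterate_logb_le (k : ℕ) : ∀ x : ℝ, 2 < x → x ≤ tower (k + 1) →
    ∃ c, 1 ≤ c ∧ c ≤ k ∧ (Real.logb 2)^[c] x ≤ 2 := by
  induction k with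
  | zero => intro x hx h; rw [zero_add, tower_one] at h; linarith
  | succ k ih =>
    intro x hx h
    by_cases h2 : Real.logb 2 x ≤ 2
    · exact ⟨1, le_rfl, by omega, h2⟩
    · obtain ⟨c, _, h4, h5⟩ := ih (Real.logb 2 x) (not_le.1 h2) (by
        rwa [Real.logb_le_iff_le_rpow (by norm_num) (by linarith)])
      exact ⟨c + 1, by omega, by omega, by rwa [Function.iterate_succ_apply]⟩

theorem two_lt_iterate_logb (c : ℕ) : ∀ x : ℝ, tower (c + 1) < x →
    2 < (Real.logb 2)^[c] x := by
  induction c with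
  | zero => intro x h; simpa [tower_one] using h
  | succ c ih =>
    intro x h
    rw [Function.iterate_succ_apply]
    refine ih _ ?_
    rwa [Real.lt_logb_iff_rpow_lt (by norm_num) ((tower_pos _).trans h)]

/-- Together with `logStar_spec`, this says that `logStar` inverts `tower` up to an additive one,
which the constants absorb. The condition `1 ≤ k` is there because `logStar` is never `0`. -/
theorem logStar_le {x : ℝ} {k : ℕ} (hk : 1 ≤ k) (h : x ≤ tower k) : logStar x ≤ k := by
  unfold logStar iterated
  rw [iterThreshold_logb]
  split_ifs with hx
  · obtain ⟨j, rfl⟩ := Nat.exists_eq_add_of_le' hk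
    obtain ⟨c, h1, h2, h3⟩ := exists_iterate_logb_le j x hx h
    exact (Nat.sInf_le (show c ∈ {c : ℕ | 1 ≤ c ∧ (Real.logb 2)^[c] x ≤ 2} from ⟨h1, h3⟩)).trans
      (by omega)
  · exact hk

theorem logStar_spec (x : ℝ) : 1 ≤ logStar x ∧ x ≤ tower (logStar x + 1) := by
  unfold logStar iterated
  rw [iterThreshold_logb]
  split_ifs with hx
  · have hne : {c : ℕ | 1 ≤ c ∧ (Real.logb 2)^[c] x ≤ 2}.Nonempty := by
      obtain ⟨k, hk, h⟩ := exists_le_tower x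
      obtain ⟨j, rfl⟩ := Nat.exists_eq_add_of_le' hk
      obtain ⟨c, h1, _, h3⟩ := exists_iterate_logb_le j x hx h
      exact ⟨c, h1, h3⟩
    obtain ⟨h1, h2⟩ := Nat.sInf_mem hne
    refine ⟨h1, ?_⟩
    by_contra! h
    exact absurd (two_lt_iterate_logb _ x h) (not_lt.2 h2)
  · refine ⟨le_rfl, (not_lt.1 hx).trans ?_⟩
    rw [← tower_one]
    exact tower_mono (by norm_num)

/-- Exponential growth beats powers, with a multiplicative constant. -/
theorem exists_rpow_le_mul_two_rpow {s : ℝ} (hs : 0 < s) :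
    ∃ c : ℝ, 1 ≤ c ∧ ∀ u : ℝ, 0 ≤ u → u ^ s ≤ c * (2 : ℝ) ^ u := by
  have hl : 0 < Real.log 2 := Real.log_pos (by norm_num)
  refine ⟨max 1 ((s / Real.log 2) ^ s), le_max_left _ _, fun u hu => ?_⟩
  have h1 : u ≤ s / Real.log 2 * Real.exp (u * Real.log 2 / s) := by
    have := Real.add_one_le_exp (u * Real.log 2 / s)
    calc u = s / Real.log 2 * (u * Real.log 2 / s) := by field_simp
      _ ≤ _ := by gcongr; linarith
  calc u ^ s ≤ (s / Real.log 2 * Real.exp (u * Real.log 2 / s)) ^ s :=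
        Real.rpow_le_rpow hu h1 hs.le
    _ = (s / Real.log 2) ^ s * (2 : ℝ) ^ u := by
        rw [Real.mul_rpow (by positivity) (by positivity), ← Real.exp_mul,
          Real.rpow_def_of_pos (by norm_num : (0 : ℝ) < 2)]
        congr 2
        field_simp
    _ ≤ _ := by gcongr; exact le_max_right _ _

/-- Exponential growth eventually beats powers. -/
theorem exists_mul_rpow_le_two_rpow (k s : ℝ) :
    ∃ w : ℝ, ∀ u : ℝ, w ≤ u → k * u ^ s ≤ (2 : ℝ) ^ u := by
  have h := isLittleO_rpow_exp_pos_mul_atTop s (Real.log_pos (by norm_num : (1 : ℝ) < 2))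
  have h1 := h.def (show (0 : ℝ) < 1 / (|k| + 1) by positivity)
  obtain ⟨w, hw⟩ := Filter.eventually_atTop.1 h1
  refine ⟨w, fun u hu => ?_⟩
  have h2 := hw u hu
  rw [← Real.rpow_def_of_pos (by norm_num : (0 : ℝ) < 2), Real.norm_eq_abs, Real.norm_eq_abs,
    abs_of_pos (Real.rpow_pos_of_pos (by norm_num : (0 : ℝ) < 2) u), div_mul_eq_mul_div, one_mul,
    le_div_iff₀ (by positivity)] at h2
  refine le_trans ?_ h2
  calc k * u ^ s ≤ |k * u ^ s| := le_abs_self _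
    _ = |u ^ s| * |k| := by rw [abs_mul, mul_comm]
    _ ≤ _ := by gcongr; linarith

/-! ### Distances between links. -/

section Geometry

variable {X : Type*} [MetricSpace X]

theorem Link.len_pos (i : Link X) : 0 < i.len := dist_pos.2 i.ne

theorem linkDist_comm (i j : Link X) : linkDist i j = linkDist j i := by
  simp only [linkDist, dist_comm j.sender, dist_comm j.receiver]
  rw [min_comm (dist i.sender j.receiver), dist_comm i.receiver j.sender]

theorem linkDist_nonneg (i j : Link X) : 0 ≤ linkDist i j := by
  simp [linkDist, dist_nonneg]

theorem linkDist_le_sender_receiver (i j : Link X) : linkDist i j ≤ dist i.sender j.receiver :=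
  (min_le_left _ _).trans (min_le_left _ _)

theorem linkDist_le_sender_receiver' (i j : Link X) : linkDist i j ≤ dist j.sender i.receiver :=
  (min_le_left _ _).trans (min_le_right _ _)

theorem linkDist_le_sender_sender (i j : Link X) : linkDist i j ≤ dist i.sender j.sender :=
  (min_le_right _ _).trans (min_le_left _ _)

theorem linkDist_le_receiver_receiver (i j : Link X) :
    linkDist i j ≤ dist i.receiver j.receiver :=
  (min_le_right _ _).trans (min_le_right _ _)

theorem linkDist_self (i : Link X) : linkDist i i = 0 :=
  le_antisymm (by simpa using linkDist_le_sender_sender i i) (linkDist_nonneg i i)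

/-- `p` is one of the two nodes of `i`. -/
def Link.IsNode (i : Link X) (p : X) : Prop := p = i.sender ∨ p = i.receiver

theorem Link.IsNode.dist_le {i : Link X} {p q : X} (hp : i.IsNode p) (hq : i.IsNode q) :
    dist p q ≤ i.len := by
  have h := i.len_pos.le
  rcases hp with rfl | rfl <;> rcases hq with rfl | rfl <;>
    simp only [dist_self, Link.len, dist_comm, le_refl, dist_nonneg]

theorem linkDist_le {i j : Link X} {p q : X} (hp : i.IsNode p) (hq : j.IsNode q) :
    linkDist i j ≤ dist p q := by
  rcases hp with rfl | rfl <;> rcases hq with rfl | rfl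
  · exact linkDist_le_sender_sender i j
  · exact linkDist_le_sender_receiver i j
  · rw [dist_comm]; exact linkDist_le_sender_receiver' i j
  · exact linkDist_le_receiver_receiver i j

theorem exists_linkDist_eq (i j : Link X) :
    ∃ p q, i.IsNode p ∧ j.IsNode q ∧ linkDist i j = dist p q := by
  unfold linkDist
  rcases min_choice (min (dist i.sender j.receiver) (dist j.sender i.receiver))
    (min (dist i.sender j.sender) (dist i.receiver j.receiver)) with h | h <;> rw [h]
  · rcases min_choice (dist i.sender j.receiver) (dist j.sender i.receiver) with h | h <;> rw [h]
    · exact ⟨_, _, .inl rfl, .inr rfl, rfl⟩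
    · exact ⟨_, _, .inr rfl, .inl rfl, dist_comm _ _⟩
  · rcases min_choice (dist i.sender j.sender) (dist i.receiver j.receiver) with h | h <;> rw [h]
    · exact ⟨_, _, .inl rfl, .inl rfl, rfl⟩
    · exact ⟨_, _, .inr rfl, .inr rfl, rfl⟩

theorem linkDist_triangle (i j k : Link X) :
    linkDist j k ≤ linkDist j i + i.len + linkDist i k := by
  obtain ⟨p, q, hp, hq, h1⟩ := exists_linkDist_eq j i
  obtain ⟨p', q', hp', hq', h2⟩ := exists_linkDist_eq i k
  rw [h1, h2]
  have := hq.dist_le hp'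
  have := linkDist_le hp hq'
  have := dist_triangle4 p q p' q'
  linarith

end Geometry

/-! ### The lower bound: a feasible set is sparse around each link. -/

section CountingBounds

variable {X : Type*} [MetricSpace X]

open Classical in
theorem card_le_B (f : ℝ → ℝ) {L : Finset (Link X)} {i : Link X} (hi : i ∈ L)
    {S : Finset (Link X)} (hS : S ⊆ L)
    (h : ∀ j ∈ S, i.len ≤ j.len ∧ linkDist i j ≤ i.len * f (j.len / i.len)) :
    S.card ≤ B f L := by
  have h1 := Finset.le_sup (f := fun i : Link X =>
    (L.filter fun j => i.len ≤ j.len ∧ linkDist i j ≤ i.len * f (j.len / i.len)).card) hi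
  refine le_trans (Finset.card_le_card fun j hj => ?_) h1
  exact Finset.mem_filter.2 ⟨hS hj, h j hj⟩

open Classical in
theorem B_le_iff (f : ℝ → ℝ) (L : Finset (Link X)) (n : ℕ) :
    B f L ≤ n ↔ ∀ i ∈ L,
      (L.filter fun j => i.len ≤ j.len ∧ linkDist i j ≤ i.len * f (j.len / i.len)).card ≤ n := by
  unfold B
  exact Finset.sup_le_iff

theorem one_le_B {f : ℝ → ℝ} (hf : 0 ≤ f 1) {L : Finset (Link X)} (hL : L.Nonempty) :
    1 ≤ B f L := by
  obtain ⟨i, hi⟩ := hL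
  refine le_trans ?_ (card_le_B f hi (S := {i}) (by simpa using hi) fun j hj => ?_)
  · simp
  · obtain rfl := Finset.mem_singleton.1 hj
    refine ⟨le_rfl, ?_⟩
    rw [linkDist_self, div_self j.len_pos.ne']
    exact mul_nonneg j.len_pos.le hf

/-- Links that are at least `l` long, all within distance `c * l` of a link of length at most `l`,
are at most as many as the neighbours of the shortest of them. -/
theorem card_le_B_const {γ c l : ℝ} (hγ : 2 * c + 1 ≤ γ) (hc : 0 ≤ c) {L S : Finset (Link X)}
    (hS : S ⊆ L) (i : Link X) (hi : i.len ≤ l)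
    (h : ∀ j ∈ S, l ≤ j.len ∧ linkDist i j ≤ c * l) : S.card ≤ B (fun _ => γ) L := by
  rcases S.eq_empty_or_nonempty with rfl | hne
  · simp
  obtain ⟨k, hk, hmin⟩ := S.exists_min_image Link.len hne
  refine card_le_B _ (hS hk) hS fun j hj => ⟨hmin j hj, ?_⟩
  -- Passing from `i` to the shortest link `k` of `S` costs `c * l + i.len + c * l`, whence `2 * c +
  -- 1`.
  have h1 := linkDist_triangle i k j
  rw [linkDist_comm k i] at h1
  have h2 := h k hk
  have h3 := h j hj
  calc linkDist k j ≤ (2 * c + 1) * l := by linarith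
    _ ≤ (2 * c + 1) * k.len := by gcongr; exact h2.1
    _ ≤ γ * k.len := by gcongr; exact k.len_pos.le
    _ = _ := mul_comm _ _

/-- Adding the hypothesis over all `k` gives `card * ∑ P ≤ (1 + c) * ∑ P`, and the positive total
cancels. -/
theorem card_le_of_sum_erase_le {ι : Type*} [DecidableEq ι] {S : Finset ι} {P : ι → ℝ} {c : ℝ}
    (hc : 0 ≤ c) (hP : ∀ j ∈ S, 0 < P j) (h : ∀ k ∈ S, ∑ j ∈ S.erase k, P j ≤ c * P k) :
    (S.card : ℝ) ≤ 1 + c := by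
  rcases S.eq_empty_or_nonempty with rfl | hne
  · simp; linarith
  have h0 : 0 < ∑ j ∈ S, P j := Finset.sum_pos hP hne
  have h1 : ∑ k ∈ S, ∑ j ∈ S, P j ≤ ∑ k ∈ S, (1 + c) * P k := by
    refine Finset.sum_le_sum fun k hk => ?_
    rw [← Finset.sum_erase_add _ _ hk]
    linarith [h k hk]
  rw [Finset.sum_const, nsmul_eq_mul, ← Finset.mul_sum] at h1
  exact le_of_mul_le_mul_right h1 h0

open Classical in
theorem Feasible.interference_le {α β N : ℝ} {S : Finset (Link X)} {P : Link X → ℝ}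
    (hβ : 0 < β) (hN : 0 ≤ N)
    {k : Link X}
    (h : β * ((∑ j ∈ S.erase k, P j / dist j.sender k.receiver ^ α) + N) ≤ P k / k.len ^ α) :
    ∑ j ∈ S.erase k, P j / dist j.sender k.receiver ^ α ≤ P k / k.len ^ α / β := by
  rw [le_div_iff₀ hβ, mul_comm]
  nlinarith

open Classical in
theorem Feasible.mono {α β N : ℝ} (hβ : 0 < β) {S T : Finset (Link X)}
    (h : Feasible α β N T) (hS : S ⊆ T) : Feasible α β N S := by
  obtain ⟨P, hP, h⟩ := h
  refine ⟨P, fun i hi => hP i (hS hi), fun i hi => ⟨fun j hj => (h i (hS hi)).1 j (hS hj), ?_⟩⟩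
  refine le_trans ?_ (h i (hS hi)).2
  gcongr β * (?_ + N)
  refine Finset.sum_le_sum_of_subset_of_nonneg (Finset.erase_subset_erase _ hS) fun j hj _ => ?_
  exact div_nonneg (hP j (Finset.mem_of_mem_erase hj)).le (Real.rpow_nonneg dist_nonneg _)

open Classical in
/-- Boundedly many links of a feasible set have their senders in a ball whose radius is of the
order of their lengths. -/
theorem Feasible.card_le_of_senders {α β N R l : ℝ} (hα : 0 < α) (hβ : 0 < β) (hN : 0 ≤ N)
    (hR : 0 ≤ R) {S : Finset (Link X)} (hS : Feasible α β N S) (x : X)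
    (h : ∀ j ∈ S, l ≤ j.len ∧ dist j.sender x ≤ R * l) :
    (S.card : ℝ) ≤ 1 + (2 * R + 1) ^ α / β := by
  obtain ⟨P, hP, hS⟩ := hS
  refine card_le_of_sum_erase_le (by positivity) hP fun k hk => ?_
  have hkl := k.len_pos
  have h1 := Feasible.interference_le hβ hN (hS k hk).2
  have h2 : ∀ j ∈ S.erase k, P j / ((2 * R + 1) * k.len) ^ α ≤
      P j / dist j.sender k.receiver ^ α := by
    intro j hj
    have hj' := Finset.mem_of_mem_erase hj
    have hd := (hS k hk).1 j hj' (Finset.ne_of_mem_erase hj)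
    have := hP j hj'
    gcongr
    have h3 := dist_triangle4 j.sender x k.sender k.receiver
    have h4 := (h j hj').2
    have h5 := (h k hk).2
    have h6 : R * l ≤ R * k.len := by gcongr; exact (h k hk).1
    rw [dist_comm] at h5
    rw [show dist k.sender k.receiver = k.len from rfl] at h3
    linarith
  have h3 := (Finset.sum_le_sum h2).trans h1
  rw [← Finset.sum_div, Real.mul_rpow (by positivity) hkl.le] at h3
  have hk' : 0 < k.len ^ α := by positivity
  have hR' : 0 < (2 * R + 1) ^ α := by positivity
  rw [div_le_iff₀ (by positivity)] at h3
  refine h3.trans (le_of_eq ?_)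
  field_simp

open Classical in
/-- Boundedly many links of a feasible set have their receivers in a ball whose radius is of the
order of their lengths. -/
theorem Feasible.card_le_of_receivers {α β N R l : ℝ} (hα : 0 < α) (hβ : 0 < β) (hN : 0 ≤ N)
    (hR : 0 ≤ R) {S : Finset (Link X)} (hS : Feasible α β N S) (x : X)
    (h : ∀ j ∈ S, l ≤ j.len ∧ dist j.receiver x ≤ R * l) :
    (S.card : ℝ) ≤ 1 + (2 * R + 1) ^ α / β := by
  obtain ⟨P, hP, hS⟩ := hS
  -- With receivers close together, the distance from the sender of `j` to the receiver of `k` is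
  -- bounded through the length of `j`, not of `k`. The right weight is therefore the signal `j`
  -- delivers to its own receiver.
  refine card_le_of_sum_erase_le (P := fun j => P j / j.len ^ α) (by positivity)
    (fun j hj => div_pos (hP j hj) (Real.rpow_pos_of_pos j.len_pos _)) fun k hk => ?_
  have h1 := Feasible.interference_le hβ hN (hS k hk).2
  have h2 : ∀ j ∈ S.erase k, P j / j.len ^ α / (2 * R + 1) ^ α ≤
      P j / dist j.sender k.receiver ^ α := by
    intro j hj
    have hj' := Finset.mem_of_mem_erase hj
    have hd := (hS k hk).1 j hj' (Finset.ne_of_mem_erase hj)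
    have := hP j hj'
    have hjl := j.len_pos
    rw [div_div, ← Real.mul_rpow hjl.le (by positivity)]
    gcongr
    have h3 := dist_triangle4 j.sender j.receiver x k.receiver
    have h4 := (h j hj').2
    have h5 := (h k hk).2
    have h6 : R * l ≤ R * j.len := by gcongr; exact (h j hj').1
    rw [dist_comm] at h5
    rw [show dist j.sender j.receiver = j.len from rfl] at h3
    linarith
  have h3 := (Finset.sum_le_sum h2).trans h1
  have hR' : 0 < (2 * R + 1) ^ α := by positivity
  rw [← Finset.sum_div, div_le_iff₀ hR'] at h3
  refine h3.trans (le_of_eq ?_)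
  ring

open Classical in
theorem Feasible.card_le {α β N γ : ℝ} (hα : 0 < α) (hβ : 0 < β) (hN : 0 ≤ N) (hγ : 0 ≤ γ)
    {S : Finset (Link X)} (hS : Feasible α β N S) (i : Link X)
    (h : ∀ j ∈ S, i.len ≤ j.len ∧ linkDist i j ≤ i.len * γ) :
    (S.card : ℝ) ≤ 2 * (1 + (2 * (γ + 1) + 1) ^ α / β) := by
  -- The node of `j` nearest to `i` is its sender or its receiver; the two cases are counted
  -- separately, which gives the factor `2`.
  have key : ∀ j ∈ S, dist j.sender i.sender ≤ (γ + 1) * i.len ∨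
      dist j.receiver i.sender ≤ (γ + 1) * i.len := by
    intro j hj
    obtain ⟨p, q, hp, hq, h1⟩ := exists_linkDist_eq i j
    have h2 := (h j hj).2
    have h3 : dist q i.sender ≤ (γ + 1) * i.len := by
      have := dist_triangle q p i.sender
      have := hp.dist_le (.inl rfl : i.IsNode i.sender)
      rw [dist_comm] at h1
      linarith
    rcases hq with rfl | rfl
    · exact .inl h3
    · exact .inr h3
  have h1 := (hS.mono hβ (S.filter_subset fun j =>
    dist j.sender i.sender ≤ (γ + 1) * i.len)).card_le_of_senders (R := γ + 1) hα hβ hN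
    (by linarith) i.sender fun j hj =>
      ⟨(h j (Finset.mem_of_mem_filter _ hj)).1, (Finset.mem_filter.1 hj).2⟩
  have h2 := (hS.mono hβ (S.filter_subset fun j =>
    ¬ dist j.sender i.sender ≤ (γ + 1) * i.len)).card_le_of_receivers (R := γ + 1) hα hβ hN
    (by linarith) i.sender fun j hj =>
      ⟨(h j (Finset.mem_of_mem_filter _ hj)).1,
        (key j (Finset.mem_of_mem_filter _ hj)).resolve_left (Finset.mem_filter.1 hj).2⟩
  rw [← S.card_filter_add_card_filter_not fun j => dist j.sender i.sender ≤ (γ + 1) * i.len]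
  push_cast
  linarith

open Classical in
theorem Schedulable.B_le {α β N γ : ℝ} (hα : 0 < α) (hβ : 0 < β) (hN : 0 ≤ N) (hγ : 0 ≤ γ)
    {L : Finset (Link X)} {k : ℕ} (hL : Schedulable α β N L k) :
    (B (fun _ => γ) L : ℝ) ≤ 2 * (1 + (2 * (γ + 1) + 1) ^ α / β) * k := by
  obtain ⟨σ, hσ, hf⟩ := hL
  set c : ℝ := 2 * (1 + (2 * (γ + 1) + 1) ^ α / β) with hc
  have hc0 : 0 ≤ c := by positivity
  refine (Nat.cast_le.2 ((B_le_iff _ _ ⌊c * k⌋₊).2 fun i hi => Nat.le_floor ?_)).trans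
    (Nat.floor_le (by positivity))
  rw [Finset.card_eq_sum_card_fiberwise (f := σ) (t := Finset.range k) fun j hj =>
    Finset.mem_coe.2 (Finset.mem_range.2 (hσ j (Finset.mem_of_mem_filter _ hj)))]
  push_cast
  refine (Finset.sum_le_sum (g := fun _ => c) fun s hs => ?_).trans (by simp [mul_comm])
  refine ((hf s (Finset.mem_range.1 hs)).mono hβ ?_).card_le hα hβ hN hγ i fun j hj => ?_
  · intro j hj
    simp only [Finset.mem_filter] at hj ⊢
    exact ⟨hj.1.1, hj.2⟩
  · simp only [Finset.mem_filter] at hj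
    exact hj.1.2

end CountingBounds

/-! ### Greedy constructions along an ordering. -/

section Orderings

variable {ι : Type*}

open Classical in
/-- A finite set can be enumerated compatibly with a real function on it. -/
theorem exists_rank (S : Finset ι) (f : ι → ℝ) :
    ∃ r : ι → ℕ, Set.InjOn r S ∧ ∀ i ∈ S, ∀ j ∈ S, r i ≤ r j → f i ≤ f j := by
  induction S using Finset.induction_on_max_value f with
  | empty => exact ⟨fun _ => 0, by simp, by simp⟩
  | insert a s ha hmax ih =>
    obtain ⟨r, hinj, hr⟩ := ih
    have hb : ∀ i ∈ s, r i < s.sup r + 1 := fun i hi => Nat.lt_succ_of_le (Finset.le_sup hi)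
    have hne : ∀ i ∈ s, i ≠ a := fun i hi h => ha (h ▸ hi)
    refine ⟨Function.update r a (s.sup r + 1), ?_, ?_⟩
    · intro i hi j hj h
      rw [Finset.mem_coe, Finset.mem_insert] at hi hj
      rcases hi with rfl | hi <;> rcases hj with rfl | hj
      · rfl
      · rw [Function.update_self, Function.update_of_ne (hne j hj)] at h
        exact absurd h (hb j hj).ne'
      · rw [Function.update_self, Function.update_of_ne (hne i hi)] at h
        exact absurd h (hb i hi).ne
      · rw [Function.update_of_ne (hne i hi), Function.update_of_ne (hne j hj)] at h
        exact hinj hi hj h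
    · intro i hi j hj h
      rw [Finset.mem_insert] at hi hj
      rcases hi with rfl | hi <;> rcases hj with rfl | hj
      · rfl
      · rw [Function.update_self, Function.update_of_ne (hne j hj)] at h
        exact absurd (hb j hj) (not_lt.2 h)
      · exact hmax i hi
      · rw [Function.update_of_ne (hne i hi), Function.update_of_ne (hne j hj)] at h
        exact hr i hi j hj h

open Classical in
/-- Positive solution of a triangular recursion, starting from the largest rank. -/
theorem exists_triangular_solution (S : Finset ι) (r : ι → ℕ) (hr : Set.InjOn r S)
    (F : ι → ι → ℝ) (hF : ∀ j k, 0 ≤ F j k) (G : ι → ℝ) (hG : ∀ j ∈ S, 0 < G j) :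
    ∃ P : ι → ℝ, (∀ j ∈ S, 0 < P j) ∧
      ∀ j ∈ S, P j = (∑ k ∈ S with r j < r k, P k * F k j) + G j := by
  induction S using Finset.induction_on_min_value r with
  | empty => exact ⟨fun _ => 0, by simp, by simp⟩
  | insert a s ha hmin ih =>
    have hne : ∀ i ∈ s, i ≠ a := fun i hi h => ha (h ▸ hi)
    obtain ⟨P, hP, hrec⟩ := ih (hr.mono (by simp)) fun j hj => hG j (Finset.mem_insert_of_mem hj)
    have hpos : 0 ≤ ∑ k ∈ s with r a < r k, P k * F k a :=
      Finset.sum_nonneg fun k hk =>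
        mul_nonneg (hP k (Finset.mem_of_mem_filter k hk)).le (hF k a)
    have hG' := hG a (Finset.mem_insert_self a s)
    -- The new element has the smallest rank, so it enters no earlier equation, and its own equation
    -- only involves values already fixed.
    refine ⟨Function.update P a ((∑ k ∈ s with r a < r k, P k * F k a) + G a), ?_, ?_⟩
    · intro j hj
      rcases Finset.mem_insert.1 hj with rfl | hj
      · rw [Function.update_self]; linarith
      · rw [Function.update_of_ne (hne j hj)]; exact hP j hj
    · intro j hj
      have hfil : (insert a s).filter (fun k => r j < r k) = s.filter fun k => r j < r k := by
        rw [Finset.filter_insert, if_neg]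
        rcases Finset.mem_insert.1 hj with rfl | hj
        · exact lt_irrefl _
        · exact not_lt.2 (hmin j hj)
      have hcongr : ∑ k ∈ s with r j < r k,
          Function.update P a ((∑ k ∈ s with r a < r k, P k * F k a) + G a) k * F k j =
          ∑ k ∈ s with r j < r k, P k * F k j :=
        Finset.sum_congr rfl fun k hk => by
          rw [Function.update_of_ne (hne k (Finset.mem_of_mem_filter k hk))]
      rw [hfil, hcongr]
      rcases Finset.mem_insert.1 hj with rfl | hj
      · rw [Function.update_self]
      · rw [Function.update_of_ne (hne j hj)]; exact hrec j hj

open Classical in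
/-- Greedy splitting: if each element receives total weight at most `q * ε` from the elements of
smaller rank, then `q` classes suffice to bring this down to `ε` within each class. -/
theorem exists_coloring_sum_le (S : Finset ι) (r : ι → ℕ) (hr : Set.InjOn r S) (w : ι → ι → ℝ)
    {q : ℕ} (hq : 0 < q) {ε : ℝ} (h : ∀ i ∈ S, ∑ j ∈ S with r j < r i, w j i ≤ q * ε) :
    ∃ σ : ι → ℕ, (∀ i ∈ S, σ i < q) ∧
      ∀ i ∈ S, ∑ j ∈ S with (r j < r i ∧ σ j = σ i), w j i ≤ ε := by
  induction S using Finset.induction_on_max_value r with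
  | empty => exact ⟨fun _ => 0, by simp, by simp⟩
  | insert a s ha hmax ih =>
    have hne : ∀ i ∈ s, i ≠ a := fun i hi h => ha (h ▸ hi)
    have hlt : ∀ i ∈ s, r i < r a := fun i hi => lt_of_le_of_ne (hmax i hi) fun he =>
      hne i hi (hr (by simp [hi]) (by simp) he)
    have hfil : ∀ i ∈ insert a s, (insert a s).filter (fun j => r j < r i) =
        s.filter fun j => r j < r i := by
      intro i hi
      rw [Finset.filter_insert, if_neg]
      rcases Finset.mem_insert.1 hi with rfl | hi
      · exact lt_irrefl _
      · exact not_lt.2 (hmax i hi)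
    obtain ⟨σ, hσ, hsum⟩ := ih (hr.mono (by simp)) fun i hi => by
      have hi' := Finset.mem_insert_of_mem (b := a) hi
      rw [← hfil i hi']
      exact h i hi'
    have hself := Finset.mem_insert_self a s
    have ha' := h a hself
    rw [hfil a hself, Finset.filter_true_of_mem hlt,
      ← Finset.sum_fiberwise_of_maps_to (t := Finset.range q) (g := σ)
        fun i hi => Finset.mem_range.2 (hσ i hi)] at ha'
    -- The weight onto `a`, at most `q * ε`, is shared among `q` classes, so some class contributes
    -- at most `ε`. Having the largest rank, `a` adds nothing to the other sums.
    obtain ⟨c, hc, hcsum⟩ := Finset.exists_le_of_sum_le (g := fun _ : ℕ => ε)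
      (Finset.nonempty_range_iff.2 hq.ne') (ha'.trans (by simp))
    refine ⟨Function.update σ a c, ?_, ?_⟩
    · intro i hi
      rcases Finset.mem_insert.1 hi with rfl | hi
      · rw [Function.update_self]; exact Finset.mem_range.1 hc
      · rw [Function.update_of_ne (hne i hi)]; exact hσ i hi
    · intro i hi
      rw [← Finset.filter_filter, hfil i hi]
      rcases Finset.mem_insert.1 hi with rfl | hi
      · rw [Function.update_self, Finset.filter_true_of_mem hlt]
        refine le_trans (le_of_eq (Finset.sum_congr (Finset.filter_congr fun j hj => ?_)
          fun _ _ => rfl)) hcsum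
        rw [Function.update_of_ne (hne j hj)]
      · rw [Function.update_of_ne (hne i hi), Finset.filter_filter]
        refine le_trans (le_of_eq (Finset.sum_congr (Finset.filter_congr fun j hj => ?_)
          fun _ _ => rfl)) (hsum i hi)
        rw [Function.update_of_ne (hne j hj)]

open Classical in
/-- Greedy colouring: a symmetric relation in which each element has fewer than `q` neighbours
with values of `f` at least its own is `q`-colourable. -/
theorem exists_coloring (S : Finset ι) (f : ι → ℝ) (R : ι → ι → Prop)
    (q : ℕ) (h : ∀ i ∈ S, (S.filter fun j => j ≠ i ∧ f i ≤ f j ∧ R i j).card < q) :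
    ∃ σ : ι → ℕ, (∀ i ∈ S, σ i < q) ∧
      ∀ i ∈ S, ∀ j ∈ S, i ≠ j → σ i = σ j → f i ≤ f j → ¬ (R i j ∧ R j i) := by
  induction S using Finset.induction_on_min_value f with
  | empty => exact ⟨fun _ => 0, by simp, by simp⟩
  | insert a s ha hmin ih =>
    have hne : ∀ i ∈ s, i ≠ a := fun i hi h => ha (h ▸ hi)
    obtain ⟨σ, hσ, hprop⟩ := ih fun i hi =>
      (Finset.card_le_card (Finset.filter_subset_filter _ (Finset.subset_insert a s))).trans_lt
        (h i (Finset.mem_insert_of_mem hi))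
    obtain ⟨c, hc, hfree⟩ : ∃ c ∈ Finset.range q, c ∉ (s.filter fun j => R a j).image σ := by
      refine Finset.exists_mem_notMem_of_card_lt_card ?_
      rw [Finset.card_range]
      refine Finset.card_image_le.trans_lt (lt_of_le_of_lt (Finset.card_le_card fun j hj => ?_)
        (h a (Finset.mem_insert_self a s)))
      obtain ⟨hj, hR⟩ := Finset.mem_filter.1 hj
      exact Finset.mem_filter.2 ⟨Finset.mem_insert_of_mem hj, hne j hj, hmin j hj, hR⟩
    have hfree' : ∀ j ∈ s, σ j = c → ¬ R a j := fun j hj hc hR =>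
      hfree (Finset.mem_image.2 ⟨j, Finset.mem_filter.2 ⟨hj, hR⟩, hc⟩)
    refine ⟨Function.update σ a c, ?_, ?_⟩
    · intro i hi
      rcases Finset.mem_insert.1 hi with rfl | hi
      · rw [Function.update_self]; exact Finset.mem_range.1 hc
      · rw [Function.update_of_ne (hne i hi)]; exact hσ i hi
    · intro i hi j hj hij hcol hf
      rw [Finset.mem_insert] at hi hj
      rcases hi with rfl | hi <;> rcases hj with rfl | hj
      · exact absurd rfl hij
      · rw [Function.update_self, Function.update_of_ne (hne j hj)] at hcol
        exact fun hR => hfree' j hj hcol.symm hR.1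
      · rw [Function.update_self, Function.update_of_ne (hne i hi)] at hcol
        exact fun hR => hfree' i hi hcol hR.2
      · rw [Function.update_of_ne (hne j hj), Function.update_of_ne (hne i hi)] at hcol
        exact hprop i hi j hj hij hcol hf

end Orderings

/-! ### Small influence from shorter links implies feasibility. -/

section Feasibility

variable {X : Type*} [MetricSpace X]

/-- The influence of the shorter link `j` on the longer link `i`. -/
noncomputable def influence (α : ℝ) (j i : Link X) : ℝ := (j.len / linkDist j i) ^ α

theorem influence_nonneg (α : ℝ) (j i : Link X) : 0 ≤ influence α j i :=
  Real.rpow_nonneg (div_nonneg j.len_pos.le (linkDist_nonneg j i)) _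

/-- Any two links are further apart than the length of the shorter one. -/
def Separated (S : Finset (Link X)) : Prop :=
  ∀ i ∈ S, ∀ j ∈ S, i ≠ j → i.len ≤ j.len → i.len < linkDist i j

theorem Separated.mono {S T : Finset (Link X)} (hT : Separated T) (h : S ⊆ T) : Separated S :=
  fun i hi j hj => hT i (h hi) j (h hj)

theorem Separated.linkDist_pos {S : Finset (Link X)} (hS : Separated S) {i j : Link X}
    (hi : i ∈ S) (hj : j ∈ S) (hij : i ≠ j) : 0 < linkDist i j := by
  rcases le_total i.len j.len with h | h
  · exact i.len_pos.trans (hS i hi j hj hij h)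
  · rw [linkDist_comm]
    exact j.len_pos.trans (hS j hj i hi hij.symm h)

theorem Separated.dist_pos {S : Finset (Link X)} (hS : Separated S) {i j : Link X}
    (hi : i ∈ S) (hj : j ∈ S) : 0 < dist j.sender i.receiver := by
  by_cases hij : i = j
  · subst hij; exact i.len_pos
  · exact (hS.linkDist_pos hi hj hij).trans_le (linkDist_le_sender_receiver' _ _)

/-- A short link `j` cannot be close to both the receiver of `i` and the sender of `k` unless
these are close to each other. -/
theorem inv_dist_mul_inv_dist_le {α : ℝ} (hα : 0 < α) {i j k : Link X}
    (hki : 0 < dist k.sender i.receiver) (hji : 0 < linkDist j i) (hjk : 0 < linkDist j k)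
    (hj : j.len < linkDist j k) :
    (j.len ^ α) * (1 / dist j.sender i.receiver ^ α) * (1 / dist k.sender j.receiver ^ α) ≤
      3 ^ α * (1 / dist k.sender i.receiver ^ α) * (influence α j i + influence α j k) := by
  have hjl := j.len_pos
  have h1 : linkDist j i ≤ dist j.sender i.receiver := linkDist_le_sender_receiver j i
  have h2 : linkDist j k ≤ dist k.sender j.receiver := linkDist_le_sender_receiver' j k
  have hd1 := hji.trans_le h1
  have hd2 := hjk.trans_le h2
  have htri : dist k.sender i.receiver ≤
      dist k.sender j.receiver + j.len + dist j.sender i.receiver := by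
    have := dist_triangle4 k.sender j.receiver j.sender i.receiver
    rw [dist_comm j.receiver j.sender] at this
    exact this
  have hi0 := influence_nonneg α j i
  have hk0 := influence_nonneg α j k
  have hc : (0 : ℝ) < 3 ^ α := by positivity
  have e1 : j.len ^ α * (1 / dist j.sender i.receiver ^ α) ≤ influence α j i := by
    rw [influence, Real.div_rpow hjl.le hji.le, mul_one_div]
    gcongr
  have e2 : j.len ^ α * (1 / dist k.sender j.receiver ^ α) ≤ influence α j k := by
    rw [influence, Real.div_rpow hjl.le hjk.le, mul_one_div]
    gcongr
  have inv_le : ∀ {d : ℝ}, 0 < d → dist k.sender i.receiver ≤ 3 * d →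
      1 / d ^ α ≤ 3 ^ α * (1 / dist k.sender i.receiver ^ α) := by
    intro d hd hle
    rw [mul_one_div, div_le_div_iff₀ (by positivity) (by positivity), one_mul,
      ← Real.mul_rpow (by norm_num) hd.le]
    exact Real.rpow_le_rpow hki.le hle hα.le
  rcases le_total (dist k.sender j.receiver) (dist j.sender i.receiver) with hle | hle
  · have h3 := inv_le hd1 (by linarith)
    calc _ = (1 / dist j.sender i.receiver ^ α) *
          (j.len ^ α * (1 / dist k.sender j.receiver ^ α)) := by ring
      _ ≤ (3 ^ α * (1 / dist k.sender i.receiver ^ α)) * influence α j k := by gcongr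
      _ ≤ _ := by gcongr; linarith
  · have h3 := inv_le hd2 (by linarith)
    calc _ = (1 / dist k.sender j.receiver ^ α) *
          (j.len ^ α * (1 / dist j.sender i.receiver ^ α)) := by ring
      _ ≤ (3 ^ α * (1 / dist k.sender i.receiver ^ α)) * influence α j i := by gcongr
      _ ≤ _ := by gcongr; linarith

/-- The total influence from shorter links below which a separated set is feasible. -/
noncomputable def influenceThreshold (α β : ℝ) : ℝ :=
  1 / (4 * (β + 4 * 3 ^ α * β ^ 2 + 2 * 3 ^ α * β))

theorem influenceThreshold_pos {α β : ℝ} (hβ : 0 < β) : 0 < influenceThreshold α β := by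
  unfold influenceThreshold; positivity

theorem influenceThreshold_spec {α β : ℝ} (hβ : 0 < β) :
    influenceThreshold α β * (β + 4 * 3 ^ α * β ^ 2 + 2 * 3 ^ α * β) = 1 / 4 := by
  unfold influenceThreshold
  have : (0 : ℝ) < 3 ^ α := by positivity
  field_simp

open Classical in
/-- A separated set of links in which every link has a small total influence from the shorter ones
is feasible: let each link in turn, from the longest to the shortest, use twice the power needed
to overcome the noise and the interference from the longer ones. -/
theorem feasible_of_sum_influence_le {α β N : ℝ} (hα : 0 < α) (hβ : 0 < β) (hN : 0 ≤ N)
    {S : Finset (Link X)} (hS : Separated S) (r : Link X → ℕ) (hr : Set.InjOn r S)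
    (hrl : ∀ i ∈ S, ∀ j ∈ S, r i ≤ r j → i.len ≤ j.len)
    (h : ∀ i ∈ S, ∑ j ∈ S with r j < r i, influence α j i ≤ influenceThreshold α β) :
    Feasible α β N S := by
  set ε := influenceThreshold α β with hε
  have hε0 : 0 < ε := influenceThreshold_pos hβ
  have hεs : ε * (β + 4 * 3 ^ α * β ^ 2 + 2 * 3 ^ α * β) = 1 / 4 := influenceThreshold_spec hβ
  -- Twice the noise contribution; the extra `1` keeps all powers positive when `N = 0`.
  set M := 2 * β * N + 1 with hM
  have hM0 : 0 < M := by positivity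
  set g : Link X → Link X → ℝ := fun k i => 1 / dist k.sender i.receiver ^ α with hg
  have hg0 : ∀ k i, 0 ≤ g k i := fun k i => by
    have : 0 ≤ dist k.sender i.receiver ^ α := Real.rpow_nonneg dist_nonneg _
    positivity
  obtain ⟨P, hP, hrec⟩ := exists_triangular_solution S r hr
    (fun k j => j.len ^ α * (2 * β * g k j))
    (fun k j => mul_nonneg (Real.rpow_nonneg j.len_pos.le _) (mul_nonneg (by positivity) (hg0 k j)))
    (fun j => j.len ^ α * M) fun j _ => mul_pos (Real.rpow_pos_of_pos j.len_pos _) hM0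
  have hrec' : ∀ j ∈ S, P j = j.len ^ α * (2 * β * ∑ k ∈ S with r j < r k, P k * g k j + M) := by
    intro j hj
    rw [mul_add, Finset.mul_sum, Finset.mul_sum, hrec j hj]
    congr 1
    exact Finset.sum_congr rfl fun k _ => by ring
  refine ⟨P, hP, fun i hi => ⟨fun j hj _ => hS.dist_pos hi hj, ?_⟩⟩
  have hil : 0 < i.len ^ α := Real.rpow_pos_of_pos i.len_pos _
  set Q := P i / i.len ^ α with hQ
  have hgi : g i i = 1 / i.len ^ α := rfl
  set U := ∑ k ∈ S with r i < r k, P k * g k i with hU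
  set T := ∑ j ∈ S with r j < r i, P j * g j i with hT
  have hQeq : Q = 2 * β * U + M := by
    rw [hQ, div_eq_iff hil.ne', hrec' i hi, mul_comm]
  have hU0 : 0 ≤ U := Finset.sum_nonneg fun k hk =>
    mul_nonneg (hP k (Finset.mem_of_mem_filter k hk)).le (hg0 k i)
  have hT0 : 0 ≤ T := Finset.sum_nonneg fun k hk =>
    mul_nonneg (hP k (Finset.mem_of_mem_filter k hk)).le (hg0 k i)
  have hsplit : ∑ k ∈ S.erase i, P k * g k i = T + U := by
    rw [hT, hU, ← Finset.sum_union]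
    · refine Finset.sum_congr ?_ fun _ _ => rfl
      ext k
      simp only [Finset.mem_erase, Finset.mem_union, Finset.mem_filter]
      constructor
      · rintro ⟨hki, hk⟩
        rcases lt_trichotomy (r k) (r i) with hlt | heq | hgt
        · exact .inl ⟨hk, hlt⟩
        · exact absurd (hr hk hi heq) hki
        · exact .inr ⟨hk, hgt⟩
      · rintro (⟨hk, hlt⟩ | ⟨hk, hlt⟩)
        · exact ⟨fun he => by simp [he] at hlt, hk⟩
        · exact ⟨fun he => by simp [he] at hlt, hk⟩
    · rw [Finset.disjoint_filter]
      intro k _ h1 h2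
      exact absurd h1 h2.asymm
  -- The term `k = i` cannot be dropped: `i` is one of the longer links to which a shorter `j`
  -- adapts its power.
  have hall : ∑ k ∈ S, P k * g k i = T + U + Q := by
    rw [← Finset.sum_erase_add _ _ hi, hsplit, hgi, mul_one_div]
  -- The interference from the shorter links, expanded by the recursion for their powers.
  have hTle : T ≤ ε * M + 2 * β * (3 ^ α * (2 * ε)) * (T + U + Q) := by
    have e1 : T = ∑ j ∈ S with r j < r i, (j.len ^ α * g j i) * M +
        2 * β * ∑ k ∈ S, P k * ∑ j ∈ S with r j < r i ∧ r j < r k,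
          j.len ^ α * g j i * g k j := by
      rw [Finset.mul_sum]
      have e2 : ∀ k ∈ S, 2 * β * (P k * ∑ j ∈ S with r j < r i ∧ r j < r k,
          j.len ^ α * g j i * g k j) = ∑ j ∈ S with r j < r i,
          if r j < r k then 2 * β * (P k * (j.len ^ α * g j i * g k j)) else 0 := by
        intro k _
        rw [← Finset.sum_filter, Finset.filter_filter, Finset.mul_sum, Finset.mul_sum]
      rw [Finset.sum_congr rfl e2, Finset.sum_comm, ← Finset.sum_add_distrib, hT]
      refine Finset.sum_congr rfl fun j hj => ?_
      rw [← Finset.sum_filter, hrec' j (Finset.mem_of_mem_filter j hj)]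
      rw [← Finset.mul_sum, show ∑ k ∈ S with r j < r k, P k * (j.len ^ α * g j i * g k j) =
        (j.len ^ α * g j i) * ∑ k ∈ S with r j < r k, P k * g k j by
          rw [Finset.mul_sum]; exact Finset.sum_congr rfl fun k _ => by ring]
      ring
    have e3 : ∑ j ∈ S with r j < r i, (j.len ^ α * g j i) * M ≤ ε * M := by
      rw [← Finset.sum_mul]
      gcongr
      refine le_trans (Finset.sum_le_sum fun j hj => ?_) (h i hi)
      obtain ⟨hj, hlt⟩ := Finset.mem_filter.1 hj
      have hji : j ≠ i := fun he => by simp [he] at hlt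
      have hd := hS.linkDist_pos hj hi hji
      rw [influence, Real.div_rpow j.len_pos.le hd.le, hg, mul_one_div]
      have := j.len_pos.le
      gcongr
      exact linkDist_le_sender_receiver j i
    have e4 : ∀ k ∈ S, P k * ∑ j ∈ S with r j < r i ∧ r j < r k, j.len ^ α * g j i * g k j ≤
        3 ^ α * (2 * ε) * (P k * g k i) := by
      intro k hk
      have hki := hS.dist_pos hi hk
      have e5 : ∑ j ∈ S with r j < r i ∧ r j < r k, j.len ^ α * g j i * g k j ≤
          ∑ j ∈ S with r j < r i ∧ r j < r k,
            3 ^ α * g k i * (influence α j i + influence α j k) := by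
        refine Finset.sum_le_sum fun j hj => ?_
        obtain ⟨hj, hlt, hlt'⟩ := Finset.mem_filter.1 hj
        have hji : j ≠ i := fun he => by simp [he] at hlt
        have hjk : j ≠ k := fun he => by simp [he] at hlt'
        exact inv_dist_mul_inv_dist_le hα hki (hS.linkDist_pos hj hi hji)
          (hS.linkDist_pos hj hk hjk) (hS j hj k hk hjk (hrl j hj k hk hlt'.le))
      have e6 : ∑ j ∈ S with r j < r i ∧ r j < r k, influence α j i ≤ ε := by
        refine le_trans (Finset.sum_le_sum_of_subset_of_nonneg ?_
          fun j _ _ => influence_nonneg α j i) (h i hi)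
        exact Finset.monotone_filter_right _ fun j _ hj => hj.1
      have e7 : ∑ j ∈ S with r j < r i ∧ r j < r k, influence α j k ≤ ε := by
        refine le_trans (Finset.sum_le_sum_of_subset_of_nonneg ?_
          fun j _ _ => influence_nonneg α j k) (h k hk)
        exact Finset.monotone_filter_right _ fun j _ hj => hj.2
      rw [← Finset.mul_sum, Finset.sum_add_distrib] at e5
      have hPk := (hP k hk).le
      have hgk := hg0 k i
      calc _ ≤ P k * (3 ^ α * g k i * (2 * ε)) := by
            gcongr
            refine e5.trans ?_
            gcongr
            linarith
        _ = _ := by ring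
    have e8 := Finset.sum_le_sum e4
    rw [← Finset.mul_sum, hall] at e8
    refine e1.le.trans ((add_le_add e3
      (mul_le_mul_of_nonneg_left e8 (by positivity : 0 ≤ 2 * β))).trans (le_of_eq ?_))
    ring
  have hβT : β * T ≤ Q / 2 := by
    have h3 : (0 : ℝ) < 3 ^ α := by positivity
    set η := 2 * β * (3 ^ α * (2 * ε)) with hη
    have hη0 : 0 < η := by positivity
    -- The inequality `hTle` is linear in `T`. Since `η ≤ 1 / 2`, the term `η * T` moves to the
    -- left, and `influenceThreshold` is chosen so that what remains yields `β * T ≤ Q / 2`. The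
    -- other half of `Q` pays for `U` and the noise.
    have k1 : β * ε + β * η + η / 2 = 1 / 4 := by rw [hη, ← hεs]; ring
    have k2 : η ≤ 1 / 2 := by nlinarith [mul_pos hβ hε0, mul_pos hβ hη0]
    have k3 : η * T ≤ T / 2 := by nlinarith
    have k4 : ε * M ≤ ε * Q := by gcongr; rw [hQeq]; nlinarith [mul_nonneg hβ.le hU0]
    have k5 : 2 * β * U ≤ Q := by linarith
    have k6 : η * (2 * β * U) ≤ η * Q := by gcongr
    have k7 : T / 2 ≤ ε * Q + η * U + η * Q := by linarith
    have k8 : β * (T / 2) ≤ β * (ε * Q + η * U + η * Q) := by gcongr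
    have k9 : (β * ε + β * η + η / 2) * Q = 1 / 4 * Q := by rw [k1]
    linarith
  have hsum : ∑ j ∈ S.erase i, P j / dist j.sender i.receiver ^ α = T + U := by
    rw [← hsplit]
    exact Finset.sum_congr rfl fun k _ => by rw [hg, mul_one_div]
  rw [hsum]
  linarith

open Classical in
/-- A separated set in which every link has a bounded total influence from the shorter ones
splits into boundedly many feasible sets. -/
theorem schedulable_of_sum_influence_le {α β N A : ℝ} (hα : 0 < α) (hβ : 0 < β) (hN : 0 ≤ N)
    {S : Finset (Link X)} (hS : Separated S) {q : ℕ} (hq : 0 < q)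
    (hA : A ≤ q * influenceThreshold α β)
    (h : ∀ i ∈ S, ∑ j ∈ S with (j ≠ i ∧ j.len ≤ i.len), influence α j i ≤ A) :
    Schedulable α β N S q := by
  obtain ⟨r, hr, hrl⟩ := exists_rank S Link.len
  obtain ⟨σ, hσ, hsum⟩ := exists_coloring_sum_le S r hr (influence α) hq
    (ε := influenceThreshold α β) fun i hi => by
      refine le_trans ?_ ((h i hi).trans hA)
      refine Finset.sum_le_sum_of_subset_of_nonneg (fun j hj => ?_)
        fun j _ _ => influence_nonneg α j i
      obtain ⟨hj, hlt⟩ := Finset.mem_filter.1 hj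
      exact Finset.mem_filter.2 ⟨hj, fun he => by simp [he] at hlt, hrl j hj i hi hlt.le⟩
  refine ⟨σ, hσ, fun c _ => ?_⟩
  have hsub := S.filter_subset fun i => σ i = c
  refine feasible_of_sum_influence_le hα hβ hN (hS.mono hsub) r (hr.mono (by exact_mod_cast hsub))
    (fun i hi j hj => hrl i (hsub hi) j (hsub hj)) fun i hi => ?_
  refine le_trans (le_of_eq (Finset.sum_congr ?_ fun _ _ => rfl)) (hsum i (hsub hi))
  have hic := (Finset.mem_filter.1 hi).2
  rw [Finset.filter_filter, hic]
  exact Finset.filter_congr fun j _ => and_comm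

end Feasibility

/-! ### The function `tlog` and its summability. -/

section TLog

theorem one_le_tlog (α m x : ℝ) : 1 ≤ tlog α m x := le_max_right _ _

theorem tlog_mono {α m x y : ℝ} (hm : m < α) (hx : 1 ≤ x) (hxy : x ≤ y) :
    tlog α m x ≤ tlog α m y := by
  have h1 : 0 ≤ Real.logb 2 x := Real.logb_nonneg (by norm_num) hx
  have h2 : Real.logb 2 x ≤ Real.logb 2 y := Real.logb_le_logb_of_le (by norm_num) (by linarith) hxy
  exact max_le_max (Real.rpow_le_rpow h1 h2 (div_nonneg (by norm_num) (by linarith))) le_rfl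

theorem tlog_two_rpow (α m y : ℝ) : tlog α m ((2 : ℝ) ^ y) = max (y ^ (2 / (α - m))) 1 := by
  rw [tlog, Real.logb_rpow (by norm_num) (by norm_num)]

theorem tlog_two_pow (α m : ℝ) (t : ℕ) :
    tlog α m ((2 : ℝ) ^ t) = max ((t : ℝ) ^ (2 / (α - m))) 1 := by
  rw [← tlog_two_rpow, Real.rpow_natCast]

/-- An exponent strictly between `m` and `α` for which the powers of `tlog` are summable. -/
noncomputable def packingExponent (α m : ℝ) : ℝ := m + (α - m) / 4

theorem summable_tlog_rpow {α m : ℝ} (hm : m < α) :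
    Summable fun t : ℕ => tlog α m ((2 : ℝ) ^ t) ^ (packingExponent α m - α) := by
  rw [← summable_nat_add_iff 1]
  have h := (summable_nat_add_iff 1).2
    (Real.summable_nat_rpow.2 (by norm_num : (-(3 / 2) : ℝ) < -1))
  refine Summable.of_nonneg_of_le (fun t => Real.rpow_nonneg
    (zero_le_one.trans (one_le_tlog _ _ _)) _) (fun t => ?_) h
  have ht : (0 : ℝ) < ((t + 1 : ℕ) : ℝ) := by positivity
  -- This is where the exponent `2 / (α - m)` of `tlog` matters. As `packingExponent α m - α = -(3 /
  -- 4) * (α - m)`, the terms are at most `t ^ (-3 / 2)`.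
  have e : (-(3 / 2) : ℝ) = 2 / (α - m) * (packingExponent α m - α) := by
    have : α - m ≠ 0 := by linarith
    rw [packingExponent]
    field_simp
    ring
  rw [e, Real.rpow_mul ht.le, tlog_two_pow]
  refine Real.rpow_le_rpow_of_nonpos (by positivity) (le_max_left _ _) ?_
  rw [packingExponent]
  linarith

theorem floor_logb_spec {x : ℝ} (hx : 1 ≤ x) :
    (2 : ℝ) ^ ⌊Real.logb 2 x⌋₊ ≤ x ∧ x < (2 : ℝ) ^ (⌊Real.logb 2 x⌋₊ + 1) := by
  have h0 : 0 < x := by linarith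
  have h1 := Nat.floor_le (Real.logb_nonneg (by norm_num : (1 : ℝ) < 2) hx)
  have h2 := Nat.lt_floor_add_one (Real.logb 2 x)
  constructor
  · rwa [Real.le_logb_iff_rpow_le (by norm_num) h0, Real.rpow_natCast] at h1
  · rw [Real.logb_lt_iff_lt_rpow (by norm_num) h0] at h2
    exact_mod_cast h2

end TLog

/-! ### Packing bounds for independent sets in doubling spaces. -/

section Packing

variable {X : Type*} [MetricSpace X]

open Classical in
theorem IsDoublingWith.card_links_le {C δ : ℝ} (hX : IsDoublingWith X C δ) {l R : ℝ}
    (hl : 0 < l) (hlR : l ≤ R) (x : X) (S : Finset (Link X))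
    (hsep : ∀ i ∈ S, ∀ j ∈ S, i ≠ j → l ≤ dist i.sender j.sender)
    (hnear : ∀ i ∈ S, dist i.sender x ≤ R) : (S.card : ℝ) ≤ C * (R / l) ^ δ := by
  have hR : 0 < R := hl.trans_le hlR
  have hinj : Set.InjOn Link.sender (S : Set (Link X)) := fun i hi j hj h => by
    by_contra hij
    have := hsep i hi j hj hij
    rw [h, dist_self] at this
    exact absurd hl (not_lt.2 this)
  have := hX (l / R) (by positivity) ((div_le_one hR).2 hlR) x R hR (S.image Link.sender)
    (by simpa [Finset.forall_mem_image] using hnear) (by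
      simp only [Finset.forall_mem_image]
      intro i hi j hj hij
      rw [div_mul_cancel₀ _ hR.ne']
      exact hsep i hi j hj fun h => hij (h ▸ rfl))
  rwa [Finset.card_image_of_injOn hinj, Real.rpow_neg (by positivity),
    ← Real.inv_rpow (by positivity), inv_div] at this

open Classical in
/-- In a separated set, boundedly many links of length about `l` are within distance `R` of a
given link. -/
theorem Separated.card_near_le {C δ : ℝ} (hX : IsDoublingWith X C δ) {l R : ℝ} (hl : 0 < l)
    (hR : 0 ≤ R) (i : Link X) {S : Finset (Link X)} (hS : Separated S)
    (h : ∀ j ∈ S, l ≤ j.len ∧ j.len ≤ 2 * l ∧ linkDist j i ≤ R) :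
    (S.card : ℝ) ≤ 2 * (C * ((R + 2 * l) / l) ^ δ) := by
  have hsep : ∀ T ⊆ S, ∀ j ∈ T, ∀ k ∈ T, j ≠ k → l ≤ dist j.sender k.sender := by
    intro T hT j hj k hk hjk
    rcases le_total j.len k.len with hle | hle
    · exact (h j (hT hj)).1.trans ((hS j (hT hj) k (hT hk) hjk hle).le.trans
        (linkDist_le_sender_sender _ _))
    · rw [dist_comm]
      exact (h k (hT hk)).1.trans ((hS k (hT hk) j (hT hj) hjk.symm hle).le.trans
        (linkDist_le_sender_sender _ _))
  have key : ∀ j ∈ S, dist j.sender i.sender ≤ R + 2 * l ∨ dist j.sender i.receiver ≤ R + 2 * l := by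
    intro j hj
    obtain ⟨p, q, hp, hq, hd⟩ := exists_linkDist_eq j i
    obtain ⟨_, h2, h3⟩ := h j hj
    have h4 : dist j.sender q ≤ R + 2 * l := by
      have := dist_triangle j.sender p q
      have := Link.IsNode.dist_le (i := j) (.inl rfl) hp
      linarith
    rcases hq with rfl | rfl
    · exact .inl h4
    · exact .inr h4
  have h1 := hX.card_links_le hl (by linarith : l ≤ R + 2 * l) i.sender
    (S.filter fun j => dist j.sender i.sender ≤ R + 2 * l) (hsep _ (Finset.filter_subset _ _))
    fun j hj => (Finset.mem_filter.1 hj).2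
  have h2 := hX.card_links_le hl (by linarith : l ≤ R + 2 * l) i.receiver
    (S.filter fun j => ¬ dist j.sender i.sender ≤ R + 2 * l) (hsep _ (Finset.filter_subset _ _))
    fun j hj => (key j (Finset.mem_filter.1 hj).1).resolve_left (Finset.mem_filter.1 hj).2
  rw [← S.card_filter_add_card_filter_not fun j => dist j.sender i.sender ≤ R + 2 * l]
  push_cast
  linarith

/-- No two links of `S` are adjacent in the conflict graph of `f`. -/
def Independent (f : ℝ → ℝ) (S : Finset (Link X)) : Prop :=
  ∀ i ∈ S, ∀ j ∈ S, i ≠ j → i.len ≤ j.len → i.len * f (j.len / i.len) < linkDist i j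

theorem Independent.separated {f : ℝ → ℝ} (hf : ∀ x, 1 ≤ f x) {S : Finset (Link X)}
    (hS : Independent f S) : Separated S := fun i hi j hj hij hle =>
  (le_mul_of_one_le_right i.len_pos.le (hf _)).trans_lt (hS i hi j hj hij hle)

/-- A bound on the total influence of the shorter links in an independent set. -/
noncomputable def influenceBound (α m C : ℝ) : ℝ :=
  2 * |C| * 8 ^ packingExponent α m * (∑' s : ℕ, ((2 : ℝ) ^ (packingExponent α m - α)) ^ s) *
    ∑' t : ℕ, tlog α m ((2 : ℝ) ^ t) ^ (packingExponent α m - α)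

open Classical in
-- Sort the shorter links `j` into cells by the dyadic size `2 ^ t` of `i.len / j.len` and the
-- dyadic size `2 ^ s` of `linkDist j i / (j.len * ρ t)`, where `ρ t = tlog (2 ^ t)`. With an
-- exponent `δ < α`, doubling allows `O((2 ^ s * ρ t) ^ δ)` links in a cell, each of influence at
-- most `(2 ^ s * ρ t) ^ (-α)`. Summing over cells gives a geometric series in `s` times the
-- convergent `∑ ρ t ^ (δ - α)`.
theorem Independent.sum_influence_le {α m C : ℝ} (hα : 0 < α) (hm0 : 0 ≤ m) (hm : m < α)
    (hX : IsDoublingWith X C (packingExponent α m)) {S : Finset (Link X)}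
    (hS : Independent (tlog α m) S) {i : Link X} (hi : i ∈ S) :
    ∑ j ∈ S with (j ≠ i ∧ j.len ≤ i.len), influence α j i ≤ influenceBound α m C := by
  set δ := packingExponent α m with hδ
  have hδ0 : 0 ≤ δ := by rw [hδ, packingExponent]; linarith
  have hδα : δ - α < 0 := by rw [hδ, packingExponent]; linarith
  set F := S.filter fun j => j ≠ i ∧ j.len ≤ i.len with hF
  set ρ : ℕ → ℝ := fun t => tlog α m ((2 : ℝ) ^ t) with hρ
  have hρ1 : ∀ t, 1 ≤ ρ t := fun t => one_le_tlog _ _ _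
  set t : Link X → ℕ := fun j => ⌊Real.logb 2 (i.len / j.len)⌋₊ with ht
  set s : Link X → ℕ := fun j => ⌊Real.logb 2 (linkDist j i / (j.len * ρ (t j)))⌋₊ with hs
  have hsep := hS.separated (one_le_tlog α m)
  have hFS : F ⊆ S := Finset.filter_subset _ _
  have htj : ∀ j ∈ F, (2 : ℝ) ^ t j ≤ i.len / j.len ∧ i.len / j.len < 2 ^ (t j + 1) := by
    intro j hj
    exact floor_logb_spec ((one_le_div j.len_pos).2 (Finset.mem_filter.1 hj).2.2)
  have hsj : ∀ j ∈ F, (2 : ℝ) ^ s j * (j.len * ρ (t j)) ≤ linkDist j i ∧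
      linkDist j i < 2 ^ (s j + 1) * (j.len * ρ (t j)) := by
    intro j hj
    obtain ⟨hjS, hji, hle⟩ := Finset.mem_filter.1 hj
    have h1 := hS j hjS i hi hji hle
    have h0 : 0 < j.len * ρ (t j) := mul_pos j.len_pos (by linarith [hρ1 (t j)])
    have h2 : j.len * ρ (t j) ≤ linkDist j i := by
      refine le_trans ?_ h1.le
      have := j.len_pos.le
      gcongr
      exact tlog_mono hm (one_le_pow₀ (by norm_num)) (htj j hj).1
    have h3 := floor_logb_spec ((one_le_div h0).2 h2)
    rwa [le_div_iff₀ h0, div_lt_iff₀ h0] at h3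
  have hcell : ∀ c : ℕ × ℕ, ∑ j ∈ F with (t j, s j) = c, influence α j i ≤
      2 * |C| * 8 ^ δ * (((2 : ℝ) ^ (δ - α)) ^ c.2 * ρ c.1 ^ (δ - α)) := by
    rintro ⟨t₀, s₀⟩
    have hmem : ∀ j ∈ F.filter (fun j => (t j, s j) = (t₀, s₀)), j ∈ F ∧ t j = t₀ ∧ s j = s₀ := by
      intro j hj
      simpa using hj
    have hρ0 : 0 < ρ t₀ := by linarith [hρ1 t₀]
    have h2s : (0 : ℝ) < 2 ^ s₀ := by positivity
    have hterm : ∀ j ∈ F.filter (fun j => (t j, s j) = (t₀, s₀)),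
        influence α j i ≤ (2 ^ s₀ * ρ t₀) ^ (-α) := by
      intro j hj
      obtain ⟨hjF, rfl, rfl⟩ := hmem j hj
      have h1 := (hsj j hjF).1
      have hjl := j.len_pos
      have hd : 0 < linkDist j i := lt_of_lt_of_le (by positivity) h1
      rw [influence, ← inv_div, Real.inv_rpow (by positivity), ← Real.rpow_neg (by positivity)]
      refine Real.rpow_le_rpow_of_nonpos (by positivity) ?_ (by linarith)
      rw [le_div_iff₀ hjl]
      linarith
    -- All links of the cell have length between `l` and `2 * l`.
    set l := i.len / 2 ^ (t₀ + 1) with hl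
    have hl0 : 0 < l := div_pos i.len_pos (by positivity)
    have hcard := (hsep.mono ((Finset.filter_subset (fun j => (t j, s j) = (t₀, s₀)) F).trans
      hFS)).card_near_le hX hl0 (R := 2 ^ (s₀ + 2) * (l * ρ t₀)) (by positivity) i
      fun j hj => by
        obtain ⟨hjF, rfl, rfl⟩ := hmem j hj
        have hjl := j.len_pos
        have h1 := htj j hjF
        rw [le_div_iff₀ hjl, div_lt_iff₀ hjl] at h1
        have h2 : j.len ≤ 2 * l := by
          rw [hl, pow_succ, ← mul_div_assoc, le_div_iff₀ (by positivity)]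
          linarith
        refine ⟨?_, h2, ?_⟩
        · rw [hl, div_le_iff₀ (by positivity)]
          linarith
        · refine (hsj j hjF).2.le.trans ?_
          calc (2 : ℝ) ^ (s j + 1) * (j.len * ρ (t j)) ≤ 2 ^ (s j + 1) * (2 * l * ρ (t j)) := by
                gcongr
            _ = _ := by ring
    have hcard' : (((F.filter fun j => (t j, s j) = (t₀, s₀)).card : ℕ) : ℝ) ≤
        2 * (|C| * (8 * (2 ^ s₀ * ρ t₀)) ^ δ) := by
      refine hcard.trans ?_
      have e : (2 ^ (s₀ + 2) * (l * ρ t₀) + 2 * l) / l ≤ 8 * (2 ^ s₀ * ρ t₀) := by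
        have e1 : (1 : ℝ) ≤ 2 ^ s₀ * ρ t₀ :=
          one_le_mul_of_one_le_of_one_le (one_le_pow₀ (by norm_num)) (hρ1 t₀)
        rw [div_le_iff₀ hl0, pow_add]
        nlinarith
      have e0 : 0 ≤ (2 ^ (s₀ + 2) * (l * ρ t₀) + 2 * l) / l := by positivity
      gcongr
      exact le_abs_self C
    refine (Finset.sum_le_card_nsmul _ _ _ hterm).trans ?_
    rw [nsmul_eq_mul]
    refine (mul_le_mul_of_nonneg_right hcard' (by positivity)).trans (le_of_eq ?_)
    have e1 : ((2 : ℝ) ^ (δ - α)) ^ s₀ = (2 ^ s₀) ^ (δ - α) := by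
      rw [← Real.rpow_natCast, ← Real.rpow_mul (by norm_num), mul_comm,
        Real.rpow_mul (by norm_num), Real.rpow_natCast]
    rw [e1, ← Real.mul_rpow (by positivity) (by positivity), sub_eq_add_neg,
      Real.rpow_add (by positivity), Real.mul_rpow (x := 8) (by positivity) (by positivity)]
    ring
  have hsum1 : Summable fun s : ℕ => ((2 : ℝ) ^ (δ - α)) ^ s :=
    summable_geometric_of_lt_one (by positivity)
      (Real.rpow_lt_one_of_one_lt_of_neg (by norm_num) hδα)
  have hsum2 : Summable fun t : ℕ => ρ t ^ (δ - α) := summable_tlog_rpow hm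
  have hρ0 : ∀ t, 0 ≤ ρ t ^ (δ - α) := fun t => Real.rpow_nonneg (by linarith [hρ1 t]) _
  rw [← Finset.sum_fiberwise_of_maps_to (t := F.image t ×ˢ F.image s) (g := fun j => (t j, s j))
    fun j hj => Finset.mk_mem_product (Finset.mem_image_of_mem t hj) (Finset.mem_image_of_mem s hj)]
  refine (Finset.sum_le_sum fun c _ => hcell c).trans ?_
  rw [← Finset.mul_sum, influenceBound, mul_assoc (2 * |C| * 8 ^ packingExponent α m)]
  gcongr
  rw [Finset.sum_product_right]
  simp only
  simp_rw [← Finset.mul_sum]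
  rw [← Finset.sum_mul]
  have h1 := hsum1.sum_le_tsum (F.image s) fun s _ => by positivity
  have h2 := hsum2.sum_le_tsum (F.image t) fun t _ => hρ0 t
  exact mul_le_mul h1 h2 (Finset.sum_nonneg fun t _ => hρ0 t) (tsum_nonneg fun s => by positivity)

end Packing

/-! ### The upper bound on `OPTS` and the gap between the two bounds. -/

section UpperBounds

variable {X : Type*} [MetricSpace X]

open Classical in
theorem Schedulable.of_coloring {α β N : ℝ} (hβ : 0 < β) {L : Finset (Link X)} {k q : ℕ}
    (σ : Link X → ℕ) (hσ : ∀ i ∈ L, σ i < k)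
    (h : ∀ c < k, Schedulable α β N (L.filter fun i => σ i = c) q) :
    Schedulable α β N L (k * q) := by
  choose! τ hτ hf using h
  have hlt : ∀ i ∈ L, τ (σ i) i < q := fun i hi =>
    hτ _ (hσ i hi) i (Finset.mem_filter.2 ⟨hi, rfl⟩)
  refine ⟨fun i => σ i * q + τ (σ i) i, fun i hi => ?_, fun c hc => ?_⟩
  · calc σ i * q + τ (σ i) i < σ i * q + q := by gcongr; exact hlt i hi
      _ = (σ i + 1) * q := by ring
      _ ≤ k * q := by gcongr; exact hσ i hi
  · have hq : 0 < q := Nat.pos_of_mul_pos_left (Nat.zero_lt_of_lt hc)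
    refine (hf (c / q) (Nat.div_lt_of_lt_mul (by rwa [mul_comm])) (c % q)
      (Nat.mod_lt _ hq)).mono hβ fun i hi => ?_
    obtain ⟨hiL, rfl⟩ := Finset.mem_filter.1 hi
    have h1 := hlt i hiL
    have h2 : (σ i * q + τ (σ i) i) / q = σ i := by
      rw [Nat.add_comm, Nat.add_mul_div_right _ _ hq, Nat.div_eq_of_lt h1, zero_add]
    have h3 : (σ i * q + τ (σ i) i) % q = τ (σ i) i := by
      rw [Nat.add_comm, Nat.add_mul_mod_self_right, Nat.mod_eq_of_lt h1]
    simp only [h2, h3, Finset.mem_filter, hiL, and_self]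

open Classical in
theorem exists_independent_coloring {f : ℝ → ℝ} (hf : 0 ≤ f 1) (L : Finset (Link X)) :
    ∃ σ : Link X → ℕ, (∀ i ∈ L, σ i < B f L) ∧
      ∀ c, Independent f (L.filter fun i => σ i = c) := by
  obtain ⟨σ, hσ, h⟩ := exists_coloring L Link.len
    (fun i j => linkDist i j ≤ min i.len j.len * f (max i.len j.len / min i.len j.len)) (B f L)
    fun i hi => by
      refine lt_of_lt_of_le ?_ (card_le_B f hi (S := L.filter fun j =>
        i.len ≤ j.len ∧ linkDist i j ≤ i.len * f (j.len / i.len)) (Finset.filter_subset _ _)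
        fun j hj => (Finset.mem_filter.1 hj).2)
      -- `B f L` also counts `i` itself, so `i` has strictly fewer than `B f L` other longer
      -- neighbours and no additional colour is needed.
      refine Finset.card_lt_card (Finset.ssubset_iff_subset_ne.2 ⟨fun j hj => ?_, fun he => ?_⟩)
      · obtain ⟨hj, _, hle, hd⟩ := Finset.mem_filter.1 hj
        rw [min_eq_left hle, max_eq_right hle] at hd
        exact Finset.mem_filter.2 ⟨hj, hle, hd⟩
      · have : i ∈ L.filter fun j => i.len ≤ j.len ∧ linkDist i j ≤ i.len * f (j.len / i.len) := by
          refine Finset.mem_filter.2 ⟨hi, le_rfl, ?_⟩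
          rw [linkDist_self, div_self i.len_pos.ne']
          exact mul_nonneg i.len_pos.le hf
        rw [← he] at this
        exact (Finset.mem_filter.1 this).2.1 rfl
  refine ⟨σ, hσ, fun c i hi j hj hij hle => ?_⟩
  obtain ⟨hi, hic⟩ := Finset.mem_filter.1 hi
  obtain ⟨hj, hjc⟩ := Finset.mem_filter.1 hj
  have h1 := h i hi j hj hij (hic.trans hjc.symm) hle
  rw [linkDist_comm j i, min_comm j.len, max_comm j.len, and_self, min_eq_left hle,
    max_eq_right hle] at h1
  exact not_le.1 h1

theorem schedulable_mul_B {α β m N C : ℝ} (hα : 0 < α) (hβ : 0 < β) (hm0 : 0 ≤ m) (hm : m < α)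
    (hN : 0 ≤ N) (hX : IsDoublingWith X C (packingExponent α m)) {q : ℕ} (hq : 0 < q)
    (hq' : influenceBound α m C ≤ q * influenceThreshold α β) (L : Finset (Link X)) :
    Schedulable α β N L (B (tlog α m) L * q) := by
  obtain ⟨σ, hσ, hind⟩ := exists_independent_coloring
    (zero_le_one.trans (one_le_tlog α m 1)) L
  exact Schedulable.of_coloring hβ σ hσ fun c _ => schedulable_of_sum_influence_le hα hβ hN
    ((hind c).separated (one_le_tlog α m)) hq hq'
    fun i hi => (hind c).sum_influence_le hα hm0 hm hX hi

theorem Delta_spec {L : Finset (Link X)} {i j : Link X} (hi : i ∈ L) (hj : j ∈ L) :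
    j.len / i.len ≤ Delta L := by
  have hfin : (Link.len '' (L : Set (Link X))).Finite := L.finite_toSet.image _
  have h1 : j.len ≤ sSup (Link.len '' (L : Set (Link X))) :=
    le_csSup hfin.bddAbove ⟨j, hj, rfl⟩
  have h2 : sInf (Link.len '' (L : Set (Link X))) ≤ i.len :=
    csInf_le hfin.bddBelow ⟨i, hi, rfl⟩
  have h3 : 0 < sInf (Link.len '' (L : Set (Link X))) := by
    obtain ⟨k, _, hk⟩ := Set.Nonempty.csInf_mem (Set.Nonempty.image _ ⟨i, hi⟩) hfin
    rw [← hk]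
    exact k.len_pos
  have := j.len_pos.le
  exact div_le_div₀ (this.trans h1) h1 h3 h2

theorem Delta_le {L : Finset (Link X)} (hL : L.Nonempty) {a b : ℝ} (ha : 0 < a)
    (h : ∀ i ∈ L, a ≤ i.len ∧ i.len ≤ b) : Delta L ≤ b / a := by
  have hne : (Link.len '' (L : Set (Link X))).Nonempty := Set.Nonempty.image _ hL
  have h1 : sSup (Link.len '' (L : Set (Link X))) ≤ b := csSup_le hne (by
    rintro _ ⟨i, hi, rfl⟩; exact (h i hi).2)
  have h2 : a ≤ sInf (Link.len '' (L : Set (Link X))) := le_csInf hne (by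
    rintro _ ⟨i, hi, rfl⟩; exact (h i hi).1)
  obtain ⟨i, hi⟩ := hL
  exact div_le_div₀ (i.len_pos.le.trans (h i hi).2) h1 ha h2

open Classical in
/-- The links counted by `B (tlog α m)` fall, by length, into about `2 log^* Δ` groups, each of
which is counted by `B γ`. -/
theorem B_tlog_le {α m c γ : ℝ} (hm : m < α) (hc : 1 ≤ c) (hγ : 2 * c + 1 ≤ γ)
    (hexp : ∀ y : ℝ, 1 ≤ y → y ^ (2 / (α - m)) ≤ c * (2 : ℝ) ^ (y ^ ((α - m) / 2)))
    (L : Finset (Link X)) :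
    B (tlog α m) L ≤ 4 * logStar (Delta L) * B (fun _ => γ) L := by
  refine (B_le_iff _ _ _).2 fun i hi => ?_
  set n := logStar (Delta L) with hn
  obtain ⟨hn1, hn2⟩ := logStar_spec (Delta L)
  have hil := i.len_pos
  set Z := L.filter fun j => i.len ≤ j.len ∧ linkDist i j ≤ i.len * tlog α m (j.len / i.len)
    with hZ
  have hZm : ∀ j ∈ Z, j ∈ L ∧ 1 ≤ j.len / i.len ∧ linkDist i j ≤ i.len * tlog α m (j.len / i.len) := by
    intro j hj
    obtain ⟨h1, h2, h3⟩ := Finset.mem_filter.1 hj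
    exact ⟨h1, (one_le_div hil).2 h2, h3⟩
  have hgroup : ∀ y z : ℝ, 1 ≤ y → tlog α m z ≤ c * y →
      (Z.filter fun j => y ≤ j.len / i.len ∧ j.len / i.len ≤ z).card ≤ B (fun _ => γ) L := by
    intro y z hy hz
    refine card_le_B_const (l := y * i.len) hγ (by linarith)
      ((Finset.filter_subset _ _).trans (Finset.filter_subset _ _)) i
      (le_mul_of_one_le_left hil.le hy) fun j hj => ?_
    obtain ⟨hjZ, h1, h2⟩ := Finset.mem_filter.1 hj
    obtain ⟨_, h3, h4⟩ := hZm j hjZ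
    refine ⟨(le_div_iff₀ hil).1 h1, h4.trans ?_⟩
    calc i.len * tlog α m (j.len / i.len) ≤ i.len * (c * y) := by
          gcongr
          exact (tlog_mono hm h3 h2).trans hz
      _ = _ := by ring
  set p := (α - m) / 2 with hp
  have hp0 : 0 < p := by rw [hp]; linarith
  have hp' : 2 / (α - m) = p⁻¹ := by rw [hp, inv_div]
  -- A breakpoint between consecutive towers, with `tlog (w k) = tower k`. On the far side, `tlog
  -- (tower (k + 1))` is at most a power of `tower k`, which `hexp` bounds by `c * w k`. Hence both
  -- pieces satisfy the condition of `hgroup`.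
  set w : ℕ → ℝ := fun k => (2 : ℝ) ^ (tower k ^ p) with hw
  have hcover : Z ⊆ (Finset.range (n + 1)).biUnion fun k =>
      (Z.filter fun j => tower k ≤ j.len / i.len ∧ j.len / i.len ≤ w k) ∪
      (Z.filter fun j => w k ≤ j.len / i.len ∧ j.len / i.len ≤ tower (k + 1)) := by
    intro j hj
    obtain ⟨hjL, h1, _⟩ := hZm j hj
    have h2 := (Delta_spec hi hjL).trans hn2
    have hex : ∃ k, j.len / i.len ≤ tower (k + 1) := ⟨_, h2⟩
    set k := Nat.find hex with hk
    have hk1 : j.len / i.len ≤ tower (k + 1) := Nat.find_spec hex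
    have hk2 : tower k ≤ j.len / i.len := by
      rcases Nat.eq_zero_or_pos k with h0 | h0
      · rw [h0]; exact h1
      · obtain ⟨k', hk'⟩ := Nat.exists_eq_add_of_le' h0
        have := Nat.find_min hex (show k' < k by omega)
        rw [hk']
        exact (not_le.1 this).le
    have hkn : k ≤ n := Nat.find_min' hex h2
    refine Finset.mem_biUnion.2 ⟨k, Finset.mem_range.2 (by omega), Finset.mem_union.2 ?_⟩
    rcases le_total (j.len / i.len) (w k) with h | h
    · exact .inl (Finset.mem_filter.2 ⟨hj, hk2, h⟩)
    · exact .inr (Finset.mem_filter.2 ⟨hj, h, hk1⟩)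
  have hcard : ∀ k ∈ Finset.range (n + 1),
      ((Z.filter fun j => tower k ≤ j.len / i.len ∧ j.len / i.len ≤ w k) ∪
      (Z.filter fun j => w k ≤ j.len / i.len ∧ j.len / i.len ≤ tower (k + 1))).card ≤
      2 * B (fun _ => γ) L := by
    intro k _
    have ht := one_le_tower k
    have h1 : 1 ≤ w k := Real.one_le_rpow (by norm_num) (by positivity)
    refine (Finset.card_union_le _ _).trans ?_
    have g1 := hgroup (tower k) (w k) ht (by
      rw [hw, tlog_two_rpow, hp', Real.rpow_rpow_inv (by linarith) hp0.ne', max_eq_left ht]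
      exact le_mul_of_one_le_left (by linarith) hc)
    have g2 := hgroup (w k) (tower (k + 1)) h1 (by
      rw [tower_succ, tlog_two_rpow]
      exact max_le (hexp _ ht) (one_le_mul_of_one_le_of_one_le hc h1))
    omega
  calc Z.card ≤ _ := Finset.card_le_card hcover
    _ ≤ ∑ k ∈ Finset.range (n + 1), 2 * B (fun _ => γ) L :=
        Finset.card_biUnion_le.trans (Finset.sum_le_sum hcard)
    _ = (n + 1) * (2 * B (fun _ => γ) L) := by simp
    -- Uses `1 ≤ logStar`.
    _ ≤ (2 * n) * (2 * B (fun _ => γ) L) := by gcongr; omega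
    _ = _ := by ring

theorem exists_tlog_group_constant {α m : ℝ} (hm : m < α) :
    ∃ c : ℝ, 1 ≤ c ∧
      ∀ y : ℝ, 1 ≤ y → y ^ (2 / (α - m)) ≤ c * (2 : ℝ) ^ (y ^ ((α - m) / 2)) := by
  have hp : 0 < (α - m) / 2 := by linarith
  obtain ⟨c, hc, h⟩ := exists_rpow_le_mul_two_rpow
    (s := 2 / (α - m) / ((α - m) / 2)) (div_pos (div_pos (by norm_num) (by linarith)) hp)
  refine ⟨c, hc, fun y hy => ?_⟩
  have := h (y ^ ((α - m) / 2)) (by positivity)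
  rwa [← Real.rpow_mul (by linarith), mul_div_cancel₀ _ hp.ne'] at this

end UpperBounds

/-! ### Chains with bounded `OPTS` and large `B (tlog α m)`. -/

section TowerChain

variable {X : Type*} [MetricSpace X]

/-- The link between two different points of a line in `X`. -/
def Link.ofLine {e : ℝ → X} (he : Isometry e) (x y : ℝ) (h : x ≠ y) : Link X :=
  ⟨e x, e y, he.injective.ne h⟩

theorem tower_lt_tower_succ (k : ℕ) : tower k < tower (k + 1) := by
  linarith [tower_add_one_le k]

theorem tower_strictMono : StrictMono tower := strictMono_nat_of_lt_succ tower_lt_tower_succ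

theorem four_mul_tower_le (k : ℕ) : 4 * tower k ≤ tower (k + 2) := by
  linarith [two_mul_tower_le k, two_mul_tower_le (k + 1)]

/-- Links of lengths `tower (k + 2), tower (k + 4), …` at distances of the order of the previous
length from each other. -/
noncomputable def towerChain {e : ℝ → X} (he : Isometry e) (k j : ℕ) : Link X :=
  Link.ofLine he (4 * tower (k + 2 * j)) (4 * tower (k + 2 * j) + tower (k + 2 * (j + 1)))
    (by linarith [tower_pos (k + 2 * (j + 1))])

variable {e : ℝ → X} (he : Isometry e) (k : ℕ)

theorem towerChain_len (j : ℕ) : (towerChain he k j).len = tower (k + 2 * (j + 1)) := by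
  simp only [Link.len, towerChain, Link.ofLine, he.dist_eq, Real.dist_eq]
  rw [abs_sub_comm, add_sub_cancel_left, abs_of_pos (tower_pos _)]

theorem towerChain_len_strictMono : StrictMono fun j => (towerChain he k j).len := by
  intro i j hij
  simp only [towerChain_len]
  exact tower_strictMono (by omega)

theorem towerChain_injective : Function.Injective (towerChain he k) := fun _ _ h =>
  (towerChain_len_strictMono he k).injective (congrArg Link.len h)

/-- Lengths advance by two tower levels, a factor of at least `4`. So link `i` ends before `2 *
tower (k + 2 * j)`, while link `j` starts at `4 * tower (k + 2 * j)`. -/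
theorem le_linkDist_towerChain {i j : ℕ} (hij : i < j) :
    2 * tower (k + 2 * j) ≤ linkDist (towerChain he k i) (towerChain he k j) := by
  obtain ⟨p, q, hp, hq, hd⟩ := exists_linkDist_eq (towerChain he k i) (towerChain he k j)
  have h1 := four_mul_tower_le (k + 2 * i)
  have h2 : tower (k + 2 * i + 2) ≤ tower (k + 2 * j) := tower_mono (by omega)
  have h3 := tower_pos (k + 2 * (j + 1))
  have h4 := tower_pos (k + 2 * i)
  have h5 : k + 2 * (i + 1) = k + 2 * i + 2 := by ring
  rw [hd]
  obtain ⟨x, rfl, hx⟩ : ∃ x, p = e x ∧ x ≤ 2 * tower (k + 2 * j) := by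
    rcases hp with rfl | rfl
    · exact ⟨_, rfl, by linarith⟩
    · exact ⟨_, rfl, by rw [h5]; linarith⟩
  obtain ⟨y, rfl, hy⟩ : ∃ y, q = e y ∧ 4 * tower (k + 2 * j) ≤ y := by
    rcases hq with rfl | rfl
    · exact ⟨_, rfl, le_rfl⟩
    · exact ⟨_, rfl, by linarith⟩
  rw [he.dist_eq, dist_comm, Real.dist_eq]
  refine le_trans ?_ (le_abs_self _)
  linarith

/-- The first links of the chain. -/
noncomputable def towerChainSet (n : ℕ) : Finset (Link X) :=
  (Finset.range (n + 1)).map ⟨towerChain he k, towerChain_injective he k⟩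

theorem forall_mem_towerChainSet {n : ℕ} {p : Link X → Prop} :
    (∀ i ∈ towerChainSet he k n, p i) ↔ ∀ j ≤ n, p (towerChain he k j) := by
  simp [towerChainSet]

theorem distinctLengths_towerChainSet (n : ℕ) : DistinctLengths (towerChainSet he k n) := by
  refine (forall_mem_towerChainSet he k).2 fun i _ => (forall_mem_towerChainSet he k).2
    fun j _ h => ?_
  rw [(towerChain_len_strictMono he k).injective h]

theorem separated_towerChainSet (n : ℕ) : Separated (towerChainSet he k n) := by
  refine (forall_mem_towerChainSet he k).2 fun i _ => (forall_mem_towerChainSet he k).2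
    fun j _ hij hle => ?_
  have hij' : i < j := lt_of_le_of_ne ((towerChain_len_strictMono he k).le_iff_le.1 hle)
    fun h => hij (h ▸ rfl)
  refine lt_of_lt_of_le ?_ (le_linkDist_towerChain he k hij')
  rw [towerChain_len]
  have h1 : tower (k + 2 * (i + 1)) ≤ tower (k + 2 * j) := tower_mono (by omega)
  linarith [tower_pos (k + 2 * j)]

theorem sum_tower_le (j : ℕ) :
    ∑ i ∈ Finset.range j, tower (k + 2 * (i + 1)) ≤ 2 * tower (k + 2 * j) := by
  induction j with
  | zero => simpa using (tower_pos k).le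
  | succ j ih =>
    rw [Finset.sum_range_succ]
    have h := four_mul_tower_le (k + 2 * j)
    have h' : k + 2 * (j + 1) = k + 2 * j + 2 := by ring
    rw [h']
    linarith [tower_pos (k + 2 * j)]

open Classical in
-- Each ratio of length to distance is at most `1`, so raising it to the power `α ≥ 1` only
-- decreases it, and the lengths grow geometrically.
theorem sum_influence_towerChainSet_le {α : ℝ} (hα : 1 ≤ α) (n : ℕ) :
    ∀ i ∈ towerChainSet he k n, ∑ j ∈ towerChainSet he k n with (j ≠ i ∧ j.len ≤ i.len),
      influence α j i ≤ 1 := by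
  refine (forall_mem_towerChainSet he k).2 fun i _ => ?_
  have hsub : (towerChainSet he k n).filter (fun j => j ≠ towerChain he k i ∧
      j.len ≤ (towerChain he k i).len) ⊆
      (Finset.range i).map ⟨towerChain he k, towerChain_injective he k⟩ := by
    intro j hj
    obtain ⟨hj, hne, hle⟩ := Finset.mem_filter.1 hj
    obtain ⟨j, _, rfl⟩ := Finset.mem_map.1 hj
    refine Finset.mem_map_of_mem _ (Finset.mem_range.2 (lt_of_le_of_ne
      ((towerChain_len_strictMono he k).le_iff_le.1 hle) fun h => hne (h ▸ rfl)))
  refine (Finset.sum_le_sum_of_subset_of_nonneg hsub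
    fun j _ _ => influence_nonneg α j _).trans ?_
  rw [Finset.sum_map]
  have hpos := tower_pos (k + 2 * i)
  calc ∑ j ∈ Finset.range i, influence α (towerChain he k j) (towerChain he k i)
      ≤ ∑ j ∈ Finset.range i, tower (k + 2 * (j + 1)) / (2 * tower (k + 2 * i)) := by
        refine Finset.sum_le_sum fun j hj => ?_
        have hj' := Finset.mem_range.1 hj
        have h1 := le_linkDist_towerChain he k hj'
        have h2 : tower (k + 2 * (j + 1)) ≤ tower (k + 2 * i) := tower_mono (by omega)
        have h3 := tower_pos (k + 2 * (j + 1))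
        rw [influence, towerChain_len]
        have h4 : tower (k + 2 * (j + 1)) / linkDist (towerChain he k j) (towerChain he k i) ≤
            tower (k + 2 * (j + 1)) / (2 * tower (k + 2 * i)) := by gcongr
        have h0 : 0 ≤ tower (k + 2 * (j + 1)) / linkDist (towerChain he k j) (towerChain he k i) :=
          div_nonneg h3.le (linkDist_nonneg _ _)
        refine le_trans ?_ h4
        refine Real.rpow_le_self_of_le_one h0 (h4.trans ?_) hα
        rw [div_le_one (by positivity)]
        linarith
    _ ≤ 1 := by
        rw [← Finset.sum_div, div_le_one (by positivity)]
        exact sum_tower_le k i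

/-- All links are neighbours of link `0`. With `z = tower (k + 2 * j)`, link `j` has length `2 ^ 2 ^
z` but is at distance at most `4 * z`; the logarithm of the length ratio is at least `2 ^ z / 2`,
and `hk` makes its power exceed `4 * z`. -/
theorem le_B_tlog_towerChainSet {α m : ℝ} (hm : m < α)
    (hk : ∀ u : ℝ, tower k ≤ u → 2 * (4 * u) ^ ((α - m) / 2) ≤ (2 : ℝ) ^ u) (n : ℕ) :
    n + 1 ≤ B (tlog α m) (towerChainSet he k n) := by
  have hp : 0 < (α - m) / 2 := by linarith
  have hcard : (towerChainSet he k n).card = n + 1 := by simp [towerChainSet]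
  rw [← hcard]
  refine card_le_B _ (i := towerChain he k 0) ?_ subset_rfl
    ((forall_mem_towerChainSet he k).2 fun j _ => ⟨?_, ?_⟩)
  · exact Finset.mem_map_of_mem _ (Finset.mem_range.2 (Nat.succ_pos n))
  · exact (towerChain_len_strictMono he k).monotone (Nat.zero_le j)
  have h1 : linkDist (towerChain he k 0) (towerChain he k j) ≤ 4 * tower (k + 2 * j) := by
    refine (linkDist_le_sender_sender _ _).trans ?_
    simp only [towerChain, Link.ofLine, he.dist_eq, Real.dist_eq]
    have : tower (k + 2 * 0) ≤ tower (k + 2 * j) := tower_mono (by omega)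
    rw [abs_sub_comm, abs_of_nonneg (by linarith)]
    linarith [tower_pos (k + 2 * 0)]
  rw [towerChain_len, towerChain_len]
  refine h1.trans ?_
  set l := tower (k + 2 * (0 + 1)) with hl
  have hl1 : 1 ≤ l := one_le_tower _
  rcases Nat.eq_zero_or_pos j with rfl | hj
  · refine (four_mul_tower_le (k + 2 * 0)).trans ?_
    exact le_mul_of_one_le_right (by linarith) (one_le_tlog _ _ _)
  · set z := tower (k + 2 * j) with hz
    have hz1 : 1 ≤ z := one_le_tower _
    have hlog : (2 : ℝ) ^ z / 2 ≤ Real.logb 2 (tower (k + 2 * (j + 1)) / l) := by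
      have e1 : tower (k + 2 * (j + 1)) = (2 : ℝ) ^ ((2 : ℝ) ^ z) := by
        rw [show k + 2 * (j + 1) = k + 2 * j + 1 + 1 by ring, tower_succ, tower_succ]
      have e2 : l = (2 : ℝ) ^ ((2 : ℝ) ^ tower k) := by
        rw [hl, show k + 2 * (0 + 1) = k + 1 + 1 by ring, tower_succ, tower_succ]
      rw [e1, e2, ← Real.rpow_sub (by norm_num), Real.logb_rpow (by norm_num) (by norm_num)]
      have e3 : tower k + 1 ≤ z := (tower_add_one_le k).trans (tower_mono (by omega))
      have e4 : (2 : ℝ) ^ (tower k + 1) ≤ 2 ^ z :=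
        Real.rpow_le_rpow_of_exponent_le (by norm_num) e3
      rw [Real.rpow_add_one (by norm_num)] at e4
      linarith
    have h2 := hk z (tower_mono (by omega))
    calc 4 * z = ((4 * z) ^ ((α - m) / 2)) ^ (2 / (α - m)) := by
          rw [← inv_div (α - m) 2, Real.rpow_rpow_inv (by linarith) hp.ne']
      _ ≤ (Real.logb 2 (tower (k + 2 * (j + 1)) / l)) ^ (2 / (α - m)) := by
          refine Real.rpow_le_rpow (by positivity) (by linarith)
            (div_nonneg (by norm_num) (by linarith))
      _ ≤ tlog α m (tower (k + 2 * (j + 1)) / l) := le_max_left _ _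
      _ ≤ _ := le_mul_of_one_le_left (zero_le_one.trans (one_le_tlog _ _ _)) hl1

theorem logStar_Delta_towerChainSet_le (n : ℕ) :
    logStar (Delta (towerChainSet he k n)) ≤ k + 2 * (n + 1) := by
  refine logStar_le (by omega) ?_
  have h := Delta_le (L := towerChainSet he k n) (a := 1) (b := tower (k + 2 * (n + 1)))
    ⟨_, Finset.mem_map_of_mem _ (Finset.mem_range.2 (Nat.succ_pos n))⟩ one_pos
    ((forall_mem_towerChainSet he k).2 fun j hj => ?_)
  · rwa [div_one] at h
  · rw [towerChain_len]
    exact ⟨one_le_tower _, tower_mono (by omega)⟩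

end TowerChain

/-! ### A power-free necessary condition for feasibility. -/

section WeakFeasibility

variable {X : Type*} [MetricSpace X]

/-- The influence of two links on each other, irrespective of their powers. -/
noncomputable def mutualInfluence (α : ℝ) (i j : Link X) : ℝ :=
  (i.len * j.len / (dist i.sender j.receiver * dist j.sender i.receiver)) ^ α

theorem mutualInfluence_nonneg (α : ℝ) (i j : Link X) : 0 ≤ mutualInfluence α i j :=
  Real.rpow_nonneg (div_nonneg (mul_nonneg i.len_pos.le j.len_pos.le)
    (mul_nonneg dist_nonneg dist_nonneg)) _

open Classical in
/-- A necessary condition for feasibility that does not mention powers. -/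
def WeaklyFeasible (α β : ℝ) (S : Finset (Link X)) : Prop :=
  ∀ i ∈ S, ∑ j ∈ S.erase i, mutualInfluence α i j ≤ 1 / β ^ 2

open Classical in
theorem WeaklyFeasible.mono {α β : ℝ} {S T : Finset (Link X)} (hT : WeaklyFeasible α β T)
    (h : S ⊆ T) : WeaklyFeasible α β S := fun i hi =>
  (Finset.sum_le_sum_of_subset_of_nonneg (Finset.erase_subset_erase _ h)
    fun j _ _ => mutualInfluence_nonneg α i j).trans (hT i (h hi))

open Classical in
-- The SINR inequality at `j` bounds `P j` below in terms of `P i`. Inserting this in the inequality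
-- at `i` cancels `P i` and leaves a factor `β ^ 2`.
theorem Feasible.weaklyFeasible {α β N : ℝ} (hβ : 0 < β) (hN : 0 ≤ N) {S : Finset (Link X)}
    (hS : Feasible α β N S) : WeaklyFeasible α β S := by
  obtain ⟨P, hP, hS⟩ := hS
  intro i hi
  have hPi := hP i hi
  have hil := i.len_pos
  have h1 := Feasible.interference_le hβ hN (hS i hi).2
  have h2 : ∀ j ∈ S.erase i, β * P i / i.len ^ α * mutualInfluence α i j ≤
      P j / dist j.sender i.receiver ^ α := by
    intro j hj
    obtain ⟨hji, hj⟩ := Finset.mem_erase.1 hj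
    have hjl := j.len_pos
    have hd1 := (hS i hi).1 j hj hji
    have hd2 := (hS j hj).1 i hi hji.symm
    have h3 := Feasible.interference_le hβ hN (hS j hj).2
    have h4 := (Finset.single_le_sum (f := fun k => P k / dist k.sender j.receiver ^ α)
      (fun k hk => div_nonneg (hP k (Finset.mem_of_mem_erase hk)).le
        (Real.rpow_nonneg dist_nonneg _)) (Finset.mem_erase.2 ⟨hji.symm, hi⟩)).trans h3
    rw [le_div_iff₀ hβ, le_div_iff₀ (by positivity)] at h4
    rw [mutualInfluence, Real.div_rpow (by positivity) (by positivity),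
      Real.mul_rpow hil.le hjl.le, Real.mul_rpow dist_nonneg dist_nonneg,
      le_div_iff₀ (by positivity)]
    refine le_trans (le_of_eq ?_) h4
    field_simp
  have h3 := (Finset.sum_le_sum h2).trans h1
  rw [← Finset.mul_sum, le_div_iff₀ hβ] at h3
  have hc : 0 < P i / i.len ^ α := by positivity
  rw [le_div_iff₀ (by positivity)]
  refine le_of_mul_le_mul_left ?_ hc
  refine le_trans (le_of_eq ?_) (h3.trans (mul_one _).ge)
  ring

open Classical in
/-- Every colouring of `L` with weakly feasible classes has at least `t` colours. -/
def NeedsColors (α β : ℝ) (t : ℕ) (L : Finset (Link X)) : Prop :=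
  ∀ σ : Link X → ℕ, (∀ c, WeaklyFeasible α β (L.filter fun i => σ i = c)) →
    t ≤ (L.image σ).card

open Classical in
theorem NeedsColors.le_OPTS {α β N : ℝ} (hβ : 0 < β) (hN : 0 ≤ N) {t : ℕ} {L : Finset (Link X)}
    (hL : NeedsColors α β t L) (hne : ∃ k, Schedulable α β N L k) : t ≤ OPTS α β N L := by
  obtain ⟨σ, hσ, hf⟩ := Nat.sInf_mem (s := {k : ℕ | Schedulable α β N L k}) hne
  refine (hL σ fun c => ?_).trans ?_
  · by_cases hc : c < OPTS α β N L
    · exact (hf c hc).weaklyFeasible hβ hN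
    · rw [Finset.filter_false_of_mem fun i hi (he : σ i = c) => hc (he ▸ hσ i hi)]
      intro i hi
      simp at hi
  · rw [← Finset.card_range (OPTS α β N L)]
    refine Finset.card_le_card fun c hc => ?_
    obtain ⟨i, hi, rfl⟩ := Finset.mem_image.1 hc
    exact Finset.mem_range.2 (hσ i hi)

end WeakFeasibility

/-! ### Invariance under similarities. -/

section Similarities

variable {X Y : Type*} [MetricSpace X] [MetricSpace Y]

/-- The image of links under an injective map. -/
def Link.map (f : X ↪ Y) : Link X ↪ Link Y where
  toFun i := ⟨f i.sender, f i.receiver, f.injective.ne i.ne⟩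
  inj' := by
    rintro ⟨s, r, h⟩ ⟨s', r', h'⟩ he
    simpa using he

/-- `f` multiplies distances by `μ`. -/
def IsSimilarity (μ : ℝ) (f : X ↪ Y) : Prop := ∀ x y, dist (f x) (f y) = μ * dist x y

variable {μ : ℝ} {f : X ↪ Y}

theorem IsSimilarity.len_map (hf : IsSimilarity μ f) (i : Link X) :
    (Link.map f i).len = μ * i.len := hf _ _

theorem IsSimilarity.linkDist_map (hμ : 0 ≤ μ) (hf : IsSimilarity μ f) (i j : Link X) :
    linkDist (Link.map f i) (Link.map f j) = μ * linkDist i j := by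
  simp only [linkDist, mul_min_of_nonneg _ _ hμ, ← hf _ _]
  rfl

theorem IsSimilarity.mutualInfluence_map (hμ : 0 < μ) (hf : IsSimilarity μ f) (α : ℝ)
    (i j : Link X) :
    mutualInfluence α (Link.map f i) (Link.map f j) = mutualInfluence α i j := by
  rw [mutualInfluence, mutualInfluence, hf.len_map, hf.len_map]
  congr 1
  rw [show dist (Link.map f i).sender (Link.map f j).receiver = μ * dist i.sender j.receiver
    from hf _ _, show dist (Link.map f j).sender (Link.map f i).receiver =
    μ * dist j.sender i.receiver from hf _ _, mul_mul_mul_comm, mul_mul_mul_comm μ _ μ,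
    mul_div_mul_left _ _ (by positivity)]

open Classical in
theorem IsSimilarity.weaklyFeasible_of_map (hμ : 0 < μ) (hf : IsSimilarity μ f) {α β : ℝ}
    {S : Finset (Link X)} (h : WeaklyFeasible α β (S.map (Link.map f))) :
    WeaklyFeasible α β S := by
  intro i hi
  have h1 := h _ (Finset.mem_map_of_mem (Link.map f) hi)
  rw [← Finset.map_erase, Finset.sum_map] at h1
  simpa only [hf.mutualInfluence_map hμ] using h1

open Classical in
theorem IsSimilarity.le_card_image_of_map (hμ : 0 < μ) (hf : IsSimilarity μ f) {α β : ℝ}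
    {t : ℕ} {S : Finset (Link X)} (hS : NeedsColors α β t S) {T : Finset (Link Y)}
    (hT : S.map (Link.map f) ⊆ T) (σ : Link Y → ℕ)
    (h : ∀ c, WeaklyFeasible α β (T.filter fun i => σ i = c)) :
    t ≤ (S.image fun i => σ (Link.map f i)).card := by
  refine hS _ fun c => hf.weaklyFeasible_of_map hμ ((h c).mono fun i hi => ?_)
  obtain ⟨j, hj, rfl⟩ := Finset.mem_map.1 hi
  obtain ⟨hj, hc⟩ := Finset.mem_filter.1 hj
  exact Finset.mem_filter.2 ⟨hT (Finset.mem_map_of_mem _ hj), hc⟩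

open Classical in
theorem IsSimilarity.needsColors_map (hμ : 0 < μ) (hf : IsSimilarity μ f) {α β : ℝ}
    {t : ℕ} {S : Finset (Link X)} (hS : NeedsColors α β t S) :
    NeedsColors α β t (S.map (Link.map f)) := by
  intro σ h
  refine (hf.le_card_image_of_map hμ hS subset_rfl σ h).trans (le_of_eq ?_)
  congr 1
  ext c
  simp

theorem IsSimilarity.independent_map (hμ : 0 < μ) (hf : IsSimilarity μ f) {γ : ℝ}
    {S : Finset (Link X)} (hS : Independent (fun _ => γ) S) :
    Independent (fun _ => γ) (S.map (Link.map f)) := by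
  simp only [Independent, Finset.forall_mem_map]
  intro i hi j hj hij hle
  rw [hf.len_map, hf.len_map] at hle
  rw [hf.len_map, hf.linkDist_map hμ.le, mul_assoc]
  exact mul_lt_mul_of_pos_left
    (hS i hi j hj (fun h => hij (h ▸ rfl)) (le_of_mul_le_mul_left hle hμ)) hμ

theorem IsSimilarity.distinctLengths_map (hμ : 0 < μ) (hf : IsSimilarity μ f)
    {S : Finset (Link X)} (hS : DistinctLengths S) :
    DistinctLengths (S.map (Link.map f)) := by
  simp only [DistinctLengths, Finset.forall_mem_map]
  intro i hi j hj h
  rw [hf.len_map, hf.len_map] at h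
  rw [hS i hi j hj (mul_left_cancel₀ hμ.ne' h)]

end Similarities

/-! ### Independent sets that need many slots. -/

section HardInstances

/-- A `γ`-independent set of links in `[-W, W]` of different lengths, at least `1`, that cannot be
split into `t` feasible sets. -/
structure HardInstance (α β γ W : ℝ) (t : ℕ) (L : Finset (Link ℝ)) : Prop where
  abs_le : ∀ i ∈ L, |i.sender| ≤ W ∧ |i.receiver| ≤ W
  one_le_len : ∀ i ∈ L, 1 ≤ i.len
  independent : Independent (fun _ => γ) L
  distinctLengths : DistinctLengths L
  needsColors : NeedsColors α β (t + 1) L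

theorem HardInstance.len_le {α β γ W : ℝ} {t : ℕ} {L : Finset (Link ℝ)}
    (h : HardInstance α β γ W t L) {i : Link ℝ} (hi : i ∈ L) : i.len ≤ 2 * W := by
  have h1 := h.abs_le i hi
  rw [Link.len, Real.dist_eq]
  linarith [abs_sub i.sender i.receiver]

theorem hardInstance_zero {α β γ W : ℝ} (hW : 1 ≤ W) :
    HardInstance α β γ W 0 {⟨0, 1, zero_ne_one⟩} where
  abs_le := by simp; constructor <;> linarith
  one_le_len := by simp [Link.len]
  independent := by simp [Independent]
  distinctLengths := by simp [DistinctLengths]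
  needsColors := fun σ _ => by simp

/-- The similarity `y ↦ μ * (y + a)` of the real line. -/
def lineSimilarity (μ a : ℝ) (hμ : 0 < μ) : ℝ ↪ ℝ where
  toFun y := μ * (y + a)
  inj' := fun _ _ h => add_right_cancel (mul_left_cancel₀ hμ.ne' h)

theorem isSimilarity_lineSimilarity (μ a : ℝ) (hμ : 0 < μ) :
    IsSimilarity μ (lineSimilarity μ a hμ) := by
  intro x y
  change |μ * (x + a) - μ * (y + a)| = μ * |x - y|
  rw [← mul_sub, add_sub_add_right_eq_sub, abs_mul, abs_of_pos hμ]

open Classical in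
/-- Scaled copies of a hard instance near the end of a long link form a harder instance: if every
copy used the colour of the long link, its links of that colour would interfere too much. -/
theorem HardInstance.step {α β γ W W' : ℝ} {t n : ℕ} {L : Finset (Link ℝ)}
    (hα : 0 < α) (hγ : 1 ≤ γ) (hW : 1 ≤ W) (hL : HardInstance α β γ W t L)
    (hn : 1 / β ^ 2 * (2 * (2 * γ + 4) * W) ^ α < n)
    (hW' : (2 * W + 1) ^ n * ((2 * γ + 4) * W) ≤ W') :
    ∃ L', HardInstance α β γ W' (t + 1) L' := by
  -- Lengths in `L` lie in `[1, 2 * W]`, so scaling by successive powers of `lam` makes the length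
  -- ranges of the copies disjoint.
  set lam : ℝ := 2 * W + 1 with hlam
  -- Copy `k` occupies `lam ^ k * [a - W, a + W]`, further from the receiver `0` of `i₀` than `γ`
  -- times its longest link, yet at a distance comparable to its scale.
  set a : ℝ := (2 * γ + 3) * W with ha
  have hlam3 : 3 ≤ lam := by linarith
  have hpow : ∀ k : ℕ, 0 < lam ^ k := fun k => by positivity
  have hpow1 : ∀ k : ℕ, 1 ≤ lam ^ k := fun k => one_le_pow₀ (by linarith)
  have hpow_lt : ∀ {k k' : ℕ}, k < k' → lam ^ k * lam ≤ lam ^ k' := fun h => by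
    rw [← pow_succ]
    exact pow_le_pow_right₀ (by linarith) h
  have haW : a + W = (2 * γ + 4) * W := by rw [ha]; ring
  have haW' : a - W = (2 * γ + 2) * W := by rw [ha]; ring
  have hγW : W ≤ γ * W := le_mul_of_one_le_left (by linarith) hγ
  set ℓ := lam ^ n * (a + W) with hℓ
  have hℓ0 : 0 < ℓ := by rw [hℓ, haW]; positivity
  have hℓW' : ℓ ≤ W' := by rw [hℓ, haW]; exact hW'
  have hkℓ : ∀ k < n, lam ^ k * (a + W) ≤ ℓ := by
    intro k hk
    have : 0 ≤ a + W := by rw [haW]; positivity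
    rw [hℓ]
    gcongr
    linarith
  set f : ℕ → (ℝ ↪ ℝ) := fun k => lineSimilarity (lam ^ k) a (hpow k) with hf
  have hsim : ∀ k, IsSimilarity (lam ^ k) (f k) := fun k => isSimilarity_lineSimilarity _ _ _
  set i₀ : Link ℝ := ⟨-ℓ, 0, by linarith⟩ with hi₀
  have hi₀len : i₀.len = ℓ := by simp [hi₀, Link.len, abs_of_pos hℓ0]
  set C : ℕ → Finset (Link ℝ) := fun k => L.map (Link.map (f k)) with hC
  set L' := insert i₀ ((Finset.range n).biUnion C) with hL'
  have hmem : ∀ i, i ∈ L' ↔ i = i₀ ∨ ∃ k < n, ∃ j ∈ L, i = Link.map (f k) j := by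
    intro i
    simp only [hL', hC, Finset.mem_insert, Finset.mem_biUnion, Finset.mem_range, Finset.mem_map,
      eq_comm]
  have hCL' : ∀ k < n, C k ⊆ L' := fun k hk i hi =>
    Finset.mem_insert_of_mem (Finset.mem_biUnion.2 ⟨k, Finset.mem_range.2 hk, hi⟩)
  have hlen : ∀ k, ∀ j ∈ L, lam ^ k ≤ (Link.map (f k) j).len ∧
      (Link.map (f k) j).len ≤ lam ^ k * (2 * W) := by
    intro k j hj
    rw [(hsim k).len_map]
    exact ⟨le_mul_of_one_le_right (hpow k).le (hL.one_le_len j hj),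
      mul_le_mul_of_nonneg_left (hL.len_le hj) (hpow k).le⟩
  have hnode : ∀ k, ∀ j ∈ L, ∀ p, (Link.map (f k) j).IsNode p →
      lam ^ k * (a - W) ≤ p ∧ p ≤ lam ^ k * (a + W) := by
    intro k j hj p hp
    have h1 := hL.abs_le j hj
    rw [_root_.abs_le, _root_.abs_le] at h1
    have h2 := (hpow k).le
    rcases hp with rfl | rfl
    · change lam ^ k * (a - W) ≤ lam ^ k * (j.sender + a) ∧
        lam ^ k * (j.sender + a) ≤ lam ^ k * (a + W)
      constructor <;> exact mul_le_mul_of_nonneg_left (by linarith) h2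
    · change lam ^ k * (a - W) ≤ lam ^ k * (j.receiver + a) ∧
        lam ^ k * (j.receiver + a) ≤ lam ^ k * (a + W)
      constructor <;> exact mul_le_mul_of_nonneg_left (by linarith) h2
  have hlen_lt : ∀ {k k'}, k < k' → ∀ j ∈ L, ∀ j' ∈ L,
      (Link.map (f k) j).len < (Link.map (f k') j').len := by
    intro k k' hk j hj j' hj'
    refine lt_of_lt_of_le ?_ ((hpow_lt hk).trans (hlen k' j' hj').1)
    refine (hlen k j hj).2.trans_lt ?_
    have := hpow k
    gcongr
    linarith
  have hlen_lt₀ : ∀ k < n, ∀ j ∈ L, (Link.map (f k) j).len < i₀.len := by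
    intro k hk j hj
    rw [hi₀len]
    refine lt_of_le_of_lt (hlen k j hj).2 (lt_of_lt_of_le ?_ (hkℓ k hk))
    have := hpow k
    rw [haW]
    gcongr
    linarith
  refine ⟨L', ?_, ?_, ?_, ?_, ?_⟩
  · intro i hi
    rcases (hmem i).1 hi with rfl | ⟨k, hk, j, hj, rfl⟩
    · simp only [hi₀, abs_neg, abs_zero, abs_of_pos hℓ0]
      exact ⟨hℓW', hℓ0.le.trans hℓW'⟩
    · have h0 : 0 ≤ lam ^ k * (a - W) := by
        have := (hpow k).le
        rw [haW']
        positivity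
      have h1 := hnode k j hj _ (.inl rfl)
      have h2 := hnode k j hj _ (.inr rfl)
      have h3 := hkℓ k hk
      rw [abs_of_nonneg (h0.trans h1.1), abs_of_nonneg (h0.trans h2.1)]
      exact ⟨by linarith, by linarith⟩
  · intro i hi
    rcases (hmem i).1 hi with rfl | ⟨k, hk, j, hj, rfl⟩
    · rw [hi₀len, hℓ, haW]
      exact one_le_mul_of_one_le_of_one_le (hpow1 n) (by nlinarith)
    · exact (hpow1 k).trans (hlen k j hj).1
  · intro i hi j hj hij hle
    rcases (hmem i).1 hi with rfl | ⟨k, hk, i, hiL, rfl⟩ <;>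
      rcases (hmem j).1 hj with rfl | ⟨k', hk', j, hjL, rfl⟩
    · exact absurd rfl hij
    · exact absurd hle (not_le.2 (hlen_lt₀ k' hk' j hjL))
    · obtain ⟨p, q, hp, hq, hd⟩ := exists_linkDist_eq (Link.map (f k) i) i₀
      have h1 := hnode k i hiL p hp
      have hq0 : q ≤ 0 := by
        rcases hq with rfl | rfl
        · exact neg_nonpos.2 hℓ0.le
        · exact le_rfl
      have h2 := (hlen k i hiL).2
      have h3 := hpow k
      rw [hd, Real.dist_eq]
      calc (Link.map (f k) i).len * γ ≤ lam ^ k * (2 * W) * γ := by gcongr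
        _ < lam ^ k * (a - W) := by
          rw [mul_assoc, haW']
          exact mul_lt_mul_of_pos_left (by linarith) h3
        _ ≤ p - q := by linarith
        _ ≤ |p - q| := le_abs_self _
    · rcases lt_trichotomy k k' with hkk | rfl | hkk
      · obtain ⟨p, q, hp, hq, hd⟩ := exists_linkDist_eq (Link.map (f k) i) (Link.map (f k') j)
        have h1 := hnode k i hiL p hp
        have h1' := hnode k' j hjL q hq
        have h2 := (hlen k i hiL).2
        have h3 := hpow k
        have h4 : lam ^ k * lam * (a - W) ≤ lam ^ k' * (a - W) := by
          have : 0 ≤ a - W := by rw [haW']; positivity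
          gcongr
          exact hpow_lt hkk
        rw [hd, dist_comm, Real.dist_eq]
        calc (Link.map (f k) i).len * γ ≤ lam ^ k * (2 * W) * γ := by gcongr
          _ < lam ^ k * (3 * (a - W) - (a + W)) := by
            rw [mul_assoc, haW', haW]
            gcongr
            linarith
          _ ≤ lam ^ k * (lam * (a - W) - (a + W)) := by
            have : 0 ≤ a - W := by rw [haW']; positivity
            gcongr
          _ ≤ q - p := by linarith
          _ ≤ |q - p| := le_abs_self _
      · exact (hsim k).independent_map (hpow k) hL.independent _ (Finset.mem_map_of_mem _ hiL)
          _ (Finset.mem_map_of_mem _ hjL) hij hle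
      · exact absurd hle (not_le.2 (hlen_lt hkk j hjL i hiL))
  · intro i hi j hj he
    rcases (hmem i).1 hi with rfl | ⟨k, hk, i, hiL, rfl⟩ <;>
      rcases (hmem j).1 hj with rfl | ⟨k', hk', j, hjL, rfl⟩
    · rfl
    · exact absurd he (hlen_lt₀ k' hk' j hjL).ne'
    · exact absurd he (hlen_lt₀ k hk i hiL).ne
    · rcases lt_trichotomy k k' with hkk | rfl | hkk
      · exact absurd he (hlen_lt hkk i hiL j hjL).ne
      · exact (hsim k).distinctLengths_map (hpow k) hL.distinctLengths _
          (Finset.mem_map_of_mem _ hiL) _ (Finset.mem_map_of_mem _ hjL) he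
      · exact absurd he (hlen_lt hkk j hjL i hiL).ne'
  · intro σ hσ
    have hcol : ∀ k < n, t + 1 ≤ (L.image fun i => σ (Link.map (f k) i)).card := fun k hk =>
      (hsim k).le_card_image_of_map (hpow k) hL.needsColors (hCL' k hk) σ hσ
    have hi₀L' : i₀ ∈ L' := Finset.mem_insert_self _ _
    -- A copy that avoids the colour of `i₀` already uses `t + 1` others. Otherwise each of the `n`
    -- copies has a link of that colour, and each such link has mutual influence with `i₀` bounded
    -- below independently of its scale.
    by_cases hex : ∃ k < n, σ i₀ ∉ L.image fun i => σ (Link.map (f k) i)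
    · obtain ⟨k, hk, hnot⟩ := hex
      calc t + 1 + 1 ≤ (L.image fun i => σ (Link.map (f k) i)).card + 1 := by
            gcongr
            exact hcol k hk
        _ = (insert (σ i₀) (L.image fun i => σ (Link.map (f k) i))).card :=
            (Finset.card_insert_of_notMem hnot).symm
        _ ≤ _ := Finset.card_le_card (Finset.insert_subset (Finset.mem_image_of_mem _ hi₀L') ?_)
      intro c hc
      obtain ⟨j, hj, rfl⟩ := Finset.mem_image.1 hc
      exact Finset.mem_image_of_mem _ (hCL' k hk (Finset.mem_map_of_mem _ hj))
    · exfalso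
      push Not at hex
      simp only [Finset.mem_image] at hex
      have : Nonempty (Link ℝ) := ⟨i₀⟩
      choose! g hg hgσ using hex
      have hsum := hσ (σ i₀) i₀ (Finset.mem_filter.2 ⟨hi₀L', rfl⟩)
      have hinj : Set.InjOn (fun k => Link.map (f k) (g k)) (Finset.range n : Set ℕ) := by
        intro k hk k' hk' he
        have hk := hg k (Finset.mem_range.1 hk)
        have hk' := hg k' (Finset.mem_range.1 hk')
        rcases lt_trichotomy k k' with h | h | h
        · exact absurd (congrArg Link.len he) (hlen_lt h _ hk _ hk').ne
        · exact h
        · exact absurd (congrArg Link.len he) (hlen_lt h _ hk' _ hk).ne'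
      have hsub : (Finset.range n).image (fun k => Link.map (f k) (g k)) ⊆
          (L'.filter fun i => σ i = σ i₀).erase i₀ := by
        intro i hi
        obtain ⟨k, hk, rfl⟩ := Finset.mem_image.1 hi
        have hk := Finset.mem_range.1 hk
        refine Finset.mem_erase.2 ⟨fun he => ?_, Finset.mem_filter.2
          ⟨hCL' k hk (Finset.mem_map_of_mem _ (hg k hk)), hgσ k hk⟩⟩
        exact absurd (congrArg Link.len he) (hlen_lt₀ k hk _ (hg k hk)).ne
      have hsum' := (Finset.sum_le_sum_of_subset_of_nonneg hsub
        fun j _ _ => mutualInfluence_nonneg α i₀ j).trans hsum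
      rw [Finset.sum_image hinj] at hsum'
      have hD : 0 < 2 * (2 * γ + 4) * W := by positivity
      have hterm : ∀ k ∈ Finset.range n, 1 / (2 * (2 * γ + 4) * W) ^ α ≤
          mutualInfluence α i₀ (Link.map (f k) (g k)) := by
        intro k hk
        have hk := Finset.mem_range.1 hk
        have hgk := hg k hk
        have h1 := hnode k _ hgk _ (.inl rfl)
        have h2 := hnode k _ hgk _ (.inr rfl)
        have h3 := (hlen k _ hgk).1
        have h4 := hpow k
        have h5 := hkℓ k hk
        have h0 : 0 < lam ^ k * (a - W) := by rw [haW']; positivity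
        set j := Link.map (f k) (g k)
        have d1 : dist i₀.sender j.receiver = j.receiver + ℓ := by
          change |(-ℓ) - j.receiver| = _
          rw [abs_sub_comm, abs_of_pos (by linarith)]
          ring
        have d2 : dist j.sender i₀.receiver = j.sender := by
          change |j.sender - 0| = _
          rw [sub_zero, abs_of_pos (by linarith)]
        rw [mutualInfluence, hi₀len, d1, d2]
        have h6 : 0 < j.receiver + ℓ := by linarith
        have h7 : 0 < j.sender := by linarith
        rw [← Real.one_rpow α, ← Real.div_rpow (by norm_num) hD.le]
        refine Real.rpow_le_rpow (by positivity) ?_ hα.le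
        rw [div_le_div_iff₀ hD (by positivity), one_mul]
        calc (j.receiver + ℓ) * j.sender ≤ (2 * ℓ) * (lam ^ k * (a + W)) := by
              gcongr
              · linarith
              · exact h1.2
          _ = ℓ * lam ^ k * (2 * (2 * γ + 4) * W) := by rw [haW]; ring
          _ ≤ ℓ * j.len * (2 * (2 * γ + 4) * W) := by gcongr
      have h8 := (Finset.card_nsmul_le_sum _ _ _ hterm).trans hsum'
      rw [Finset.card_range, nsmul_eq_mul, mul_one_div, div_le_iff₀ (by positivity)] at h8
      linarith

/-- A step takes about `W ^ α` copies and so multiplies the scale by `(2 * W + 1) ^ O(W ^ α)`. For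
large `W` the result is below `2 ^ 2 ^ W`, that is, two tower levels per step; `k` makes the initial
`W` large enough. -/
theorem exists_hardInstance {α β γ : ℝ} (hα : 0 < α) (hγ : 1 ≤ γ) :
    ∃ k : ℕ, ∀ t : ℕ, ∃ L, HardInstance α β γ (tower (k + 2 * t)) t L := by
  set c := 2 * (2 * γ + 4) with hc
  obtain ⟨w, hw⟩ := exists_mul_rpow_le_two_rpow (2 * (1 / β ^ 2 * c ^ α) + 2 + c) (α + 1)
  obtain ⟨k, _, hk⟩ := exists_le_tower w
  refine ⟨k, fun t => ?_⟩
  induction t with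
  | zero => exact ⟨_, hardInstance_zero (one_le_tower _)⟩
  | succ t ih =>
    obtain ⟨L, hL⟩ := ih
    set W := tower (k + 2 * t) with hWdef
    have hW : 1 ≤ W := one_le_tower _
    have hwW : w ≤ W := hk.trans (tower_mono (by omega))
    set b := 1 / β ^ 2 * (c * W) ^ α with hb
    have hb0 : 0 ≤ b := by positivity
    refine hL.step (n := ⌊b⌋₊ + 1) hα hγ hW (by push_cast; exact Nat.lt_floor_add_one b) ?_
    rw [show k + 2 * (t + 1) = k + 2 * t + 1 + 1 by ring, tower_succ, tower_succ, ← hWdef]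
    set n := ⌊b⌋₊ + 1 with hn
    have hnb : (n : ℝ) ≤ b + 1 := by
      rw [hn]
      push_cast
      linarith [Nat.floor_le hb0]
    have hc1 : 1 ≤ c * W := one_le_mul_of_one_le_of_one_le (by linarith) hW
    have h1 : (2 * W + 1) ^ n ≤ (2 : ℝ) ^ (2 * W * n) := by
      rw [Real.rpow_mul (by norm_num), Real.rpow_natCast]
      gcongr
      exact add_one_le_two_rpow (by linarith)
    have h2 : (2 * γ + 4) * W ≤ (2 : ℝ) ^ (c * W) := by
      have := add_one_le_two_rpow hc1
      have : (2 * γ + 4) * W ≤ c * W := by gcongr; linarith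
      linarith
    have h3 : W * W ^ α = W ^ (α + 1) := by
      rw [Real.rpow_add_one (by positivity), mul_comm]
    have h4 : W ≤ W ^ (α + 1) := by
      rw [← h3]
      exact le_mul_of_one_le_right (by linarith) (Real.one_le_rpow hW hα.le)
    have hexp : 2 * W * n + c * W ≤ (2 : ℝ) ^ W := by
      refine le_trans ?_ (hw W hwW)
      calc 2 * W * n + c * W ≤ 2 * W * (b + 1) + c * W := by gcongr
        _ = 2 * (1 / β ^ 2 * c ^ α) * (W * W ^ α) + (2 + c) * W := by
          rw [hb, Real.mul_rpow (by positivity) (by positivity)]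
          ring
        _ ≤ 2 * (1 / β ^ 2 * c ^ α) * W ^ (α + 1) + (2 + c) * W ^ (α + 1) := by
          rw [h3]
          gcongr
        _ = _ := by ring
    calc (2 * W + 1) ^ n * ((2 * γ + 4) * W) ≤ (2 : ℝ) ^ (2 * W * n) * (2 : ℝ) ^ (c * W) := by
          gcongr
      _ = (2 : ℝ) ^ (2 * W * n + c * W) := (Real.rpow_add (by norm_num) _ _).symm
      _ ≤ _ := Real.rpow_le_rpow_of_exponent_le (by norm_num) hexp

end HardInstances

/-! ### Assembly of the main theorem. -/

theorem doublingDim_nonneg (X : Type*) [MetricSpace X] : 0 ≤ doublingDim X :=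
  Real.sInf_nonneg fun _ h => h.1.le

theorem exists_logStar_le_of_Delta_lt {X : Type*} [MetricSpace X] (D : ℝ) :
    ∃ k : ℕ, ∀ L : Finset (Link X), Delta L < D → logStar (Delta L) ≤ k := by
  obtain ⟨k, hk, h⟩ := exists_le_tower D
  exact ⟨k, fun L hL => logStar_le hk (hL.le.trans h)⟩

open Classical in
theorem B_le_one_of_independent {X : Type*} [MetricSpace X] {f : ℝ → ℝ} {L : Finset (Link X)}
    (hL : Independent f L) : B f L ≤ 1 := by
  refine (B_le_iff _ _ _).2 fun i hi => ?_
  rw [← Finset.card_singleton i]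
  refine Finset.card_le_card fun j hj => ?_
  obtain ⟨hj, hle, hd⟩ := Finset.mem_filter.1 hj
  by_contra hij
  exact absurd (hL i hi j hj (fun h => hij (by simp [h])) hle) (not_lt.2 hd)

end SINR

theorem mainTheorem7 (α β m : ℝ) (C : ℝ → ℝ)
    (hα : 2 < α) (hα' : α < 6) (hβ : 0 < β) (hm : m < α) :
    ∃ a b γ K c : ℝ, 0 < a ∧ 0 < b ∧ 1 ≤ γ ∧ 0 < K ∧ 0 < c ∧
      ∀ (X : Type*) [MetricSpace X], SINR.doublingDim X = m →
        (∀ δ : ℝ, m < δ → SINR.IsDoublingWith X (C δ) δ) → ∀ N : ℝ, 0 ≤ N →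
        (∀ L : Finset (SINR.Link X), L.Nonempty →
          a * (SINR.B (fun _ => γ) L : ℝ) ≤ (SINR.OPTS α β N L : ℝ) ∧
          (SINR.OPTS α β N L : ℝ) ≤ b * (SINR.B (SINR.tlog α m) L : ℝ) ∧
          (SINR.B (SINR.tlog α m) L : ℝ) / (SINR.B (fun _ => γ) L : ℝ)
            ≤ K * (SINR.logStar (SINR.Delta L) : ℝ)) ∧
        ((∃ e : ℝ → X, Isometry e) → ∀ D : ℝ,
          (∃ L' : Finset (SINR.Link X), L'.Nonempty ∧ SINR.DistinctLengths L' ∧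
            D ≤ SINR.Delta L' ∧
            c * (SINR.logStar (SINR.Delta L') : ℝ)
              ≤ (SINR.OPTS α β N L' : ℝ) / (SINR.B (fun _ => γ) L' : ℝ)) ∧
          (∃ L'' : Finset (SINR.Link X), L''.Nonempty ∧ SINR.DistinctLengths L'' ∧
            D ≤ SINR.Delta L'' ∧
            c * (SINR.logStar (SINR.Delta L'') : ℝ)
              ≤ (SINR.B (SINR.tlog α m) L'' : ℝ) / (SINR.OPTS α β N L'' : ℝ))) := by
  have hα0 : 0 < α := by linarith
  obtain ⟨g, hg1, hexp⟩ := SINR.exists_tlog_group_constant hm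
  set γ : ℝ := 2 * g + 1 with hγ
  have hγ1 : 1 ≤ γ := by linarith
  set Cδ := C (SINR.packingExponent α m) with hCδ
  have hε := SINR.influenceThreshold_pos (α := α) hβ
  -- One `q` serves for independent classes (`influenceBound`) and for the tower chains (influence
  -- at most `1`).
  obtain ⟨q, hq⟩ := exists_nat_ge
    (max (SINR.influenceBound α m Cδ) 1 / SINR.influenceThreshold α β)
  rw [div_le_iff₀ hε] at hq
  have hq0 : 0 < q := by
    rcases Nat.eq_zero_or_pos q with rfl | h
    · have := (le_max_right (SINR.influenceBound α m Cδ) 1).trans hq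
      norm_num at this
    · exact h
  have hqR : (0 : ℝ) < q := by exact_mod_cast hq0
  obtain ⟨k₁, hk₁⟩ := SINR.exists_hardInstance (β := β) hα0 hγ1
  obtain ⟨w, hw⟩ := SINR.exists_mul_rpow_le_two_rpow (2 * 4 ^ ((α - m) / 2)) ((α - m) / 2)
  obtain ⟨k₂, _, hk₂⟩ := SINR.exists_le_tower w
  set A : ℝ := 2 * (1 + (2 * (γ + 1) + 1) ^ α / β) with hA
  have hA0 : 0 < A := by positivity
  set k := max k₁ k₂ with hk
  set c : ℝ := 1 / (q * (k + 2)) with hc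
  have hc0 : 0 < c := by positivity
  -- Both examples have `logStar Δ ≤ k + 2 * (n + 1)` and a ratio of at least `(n + 1) / q`.
  have hck : ∀ n l : ℕ, l ≤ k + 2 * (n + 1) → c * l ≤ ((n : ℝ) + 1) / q := by
    intro n l hl
    have hl' : (l : ℝ) ≤ k + 2 * (n + 1) := by exact_mod_cast hl
    have : (l : ℝ) ≤ (k + 2) * (n + 1) := by
      nlinarith [Nat.cast_nonneg (α := ℝ) k, Nat.cast_nonneg (α := ℝ) n]
    calc c * l ≤ c * ((k + 2) * (n + 1)) := by gcongr
      _ = _ := by rw [hc]; field_simp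
  refine ⟨1 / A, q, γ, 4, c, by positivity, hqR, hγ1, by norm_num, hc0, ?_⟩
  intro X _ hdim hX N hN
  have hm0 : 0 ≤ m := hdim ▸ SINR.doublingDim_nonneg X
  have hXδ := hX (SINR.packingExponent α m) (by rw [SINR.packingExponent]; linarith)
  have hsched : ∀ L : Finset (SINR.Link X),
      SINR.Schedulable α β N L (SINR.B (SINR.tlog α m) L * q) :=
    SINR.schedulable_mul_B hα0 hβ hm0 hm hN hXδ hq0 ((le_max_left _ _).trans hq)
  have hOPTS : ∀ L : Finset (SINR.Link X), SINR.Schedulable α β N L (SINR.OPTS α β N L) :=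
    fun L => Nat.sInf_mem (s := {k : ℕ | SINR.Schedulable α β N L k}) ⟨_, hsched L⟩
  have hlower : ∀ L : Finset (SINR.Link X),
      (SINR.B (fun _ => γ) L : ℝ) ≤ A * SINR.OPTS α β N L := fun L =>
    (hOPTS L).B_le hα0 hβ hN (by linarith)
  have hBγ : ∀ L : Finset (SINR.Link X), L.Nonempty → 1 ≤ SINR.B (fun _ => γ) L := fun L hL =>
    SINR.one_le_B (by linarith) hL
  have hupper : ∀ L : Finset (SINR.Link X),
      SINR.OPTS α β N L ≤ SINR.B (SINR.tlog α m) L * q := fun L =>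
    Nat.sInf_le (show _ ∈ {k : ℕ | SINR.Schedulable α β N L k} from hsched L)
  have hgap : ∀ L : Finset (SINR.Link X), SINR.B (SINR.tlog α m) L ≤
      4 * SINR.logStar (SINR.Delta L) * SINR.B (fun _ => γ) L :=
    SINR.B_tlog_le hm hg1 hγ.ge hexp
  refine ⟨fun L hL => ⟨?_, ?_, ?_⟩, ?_⟩
  · rw [one_div, inv_mul_le_iff₀ hA0]
    exact hlower L
  · rw [mul_comm]
    exact_mod_cast hupper L
  · have := hBγ L hL
    rw [div_le_iff₀ (by exact_mod_cast this)]
    exact_mod_cast hgap L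
  rintro ⟨e, he⟩ D
  obtain ⟨l, hl⟩ := SINR.exists_logStar_le_of_Delta_lt (X := X) D
  constructor
  -- The gap bound already proved forces `Δ ≥ D`: since `B_γ = 1`, if `Δ < D` then `OPTS ≤ 4 * l *
  -- q`, fewer slots than this instance needs.
  · obtain ⟨L, hL⟩ := hk₁ (4 * l * q)
    set n := 4 * l * q with hn
    have hsim : SINR.IsSimilarity 1 (⟨e, he.injective⟩ : ℝ ↪ X) := fun x y => by
      rw [one_mul]; exact he.dist_eq x y
    set L' := L.map (SINR.Link.map ⟨e, he.injective⟩) with hL'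
    have hopt : n + 1 ≤ SINR.OPTS α β N L' :=
      (hsim.needsColors_map one_pos hL.needsColors).le_OPTS hβ hN ⟨_, hsched _⟩
    have hB := SINR.B_le_one_of_independent (hsim.independent_map one_pos hL.independent)
    have hne : L'.Nonempty := by
      rw [Finset.nonempty_iff_ne_empty]
      intro h0
      have h1 := hupper L'
      have h2 : SINR.B (SINR.tlog α m) L' = 0 := by rw [h0]; rfl
      rw [h2] at h1
      omega
    have hB1 : SINR.B (fun _ => γ) L' = 1 := le_antisymm hB (hBγ L' hne)
    refine ⟨L', hne, hsim.distinctLengths_map one_pos hL.distinctLengths, ?_, ?_⟩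
    · by_contra! hD
      have h1 := hl L' hD
      have h2 := hupper L'
      have h3 := hgap L'
      rw [hB1, mul_one] at h3
      have h4 : SINR.B (SINR.tlog α m) L' * q ≤ 4 * l * q := by gcongr; omega
      omega
    · rw [hB1, Nat.cast_one, div_one]
      have h1 : SINR.logStar (SINR.Delta L') ≤ k + 2 * (n + 1) := by
        refine SINR.logStar_le (by omega) ?_
        have h2 := SINR.Delta_le (b := 2 * SINR.tower (k₁ + 2 * n)) hne one_pos (by
          rw [hL', Finset.forall_mem_map]
          intro i hi
          rw [hsim.len_map, one_mul]
          exact ⟨hL.one_le_len i hi, hL.len_le hi⟩)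
        rw [div_one] at h2
        exact h2.trans ((SINR.two_mul_tower_le _).trans (SINR.tower_mono (by omega)))
      refine (hck n _ h1).trans ((div_le_self (by positivity) (by exact_mod_cast hq0)).trans ?_)
      exact_mod_cast hopt
  -- As before, `n` is chosen against the gap bound: `Δ < D` would give `B (tlog α m) ≤ 4 * l *
  -- B_γ`, while `B_γ ≤ A * OPTS ≤ A * q`.
  · set n := ⌈4 * l * (A * q)⌉₊ with hn
    have hnle : 4 * l * (A * q) ≤ n := Nat.le_ceil _
    set L := SINR.towerChainSet he k n with hL
    have hne : L.Nonempty := ⟨_, Finset.mem_map_of_mem _ (Finset.mem_range.2 (Nat.succ_pos n))⟩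
    have hopt : SINR.OPTS α β N L ≤ q := Nat.sInf_le
      (show q ∈ {k : ℕ | SINR.Schedulable α β N L k} from
        SINR.schedulable_of_sum_influence_le hα0 hβ hN (SINR.separated_towerChainSet he k n) hq0
          ((le_max_right _ _).trans hq)
          (SINR.sum_influence_towerChainSet_le he k (by linarith) n))
    have hB : n + 1 ≤ SINR.B (SINR.tlog α m) L := by
      refine SINR.le_B_tlog_towerChainSet he k hm (fun u hu => ?_) n
      have hwu : w ≤ u := hk₂.trans ((SINR.tower_mono (le_max_right k₁ k₂)).trans hu)
      have hu0 : 0 < u := (SINR.tower_pos k).trans_le hu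
      rw [Real.mul_rpow (by norm_num) hu0.le, ← mul_assoc]
      exact hw u hwu
    have hoptR : (SINR.OPTS α β N L : ℝ) ≤ q := by exact_mod_cast hopt
    have hBR : (n : ℝ) + 1 ≤ SINR.B (SINR.tlog α m) L := by exact_mod_cast hB
    have hpos : (0 : ℝ) < SINR.OPTS α β N L := by
      have h1 : (1 : ℝ) ≤ SINR.B (fun _ => γ) L := by exact_mod_cast hBγ L hne
      exact pos_of_mul_pos_right (by linarith [hlower L]) hA0.le
    refine ⟨L, hne, SINR.distinctLengths_towerChainSet he k n, ?_, ?_⟩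
    · by_contra! hD
      have h1 : (SINR.logStar (SINR.Delta L) : ℝ) ≤ l := by exact_mod_cast hl L hD
      have h2 : (SINR.B (SINR.tlog α m) L : ℝ) ≤
          4 * SINR.logStar (SINR.Delta L) * SINR.B (fun _ => γ) L := by exact_mod_cast hgap L
      have h3 : (SINR.B (SINR.tlog α m) L : ℝ) ≤ 4 * l * (A * q) := by
        refine h2.trans ?_
        gcongr
        exact (hlower L).trans (by gcongr)
      linarith
    · refine (hck n _ (SINR.logStar_Delta_towerChainSet_le he k n)).trans ?_
      exact div_le_div₀ (Nat.cast_nonneg _) hBR hpos hoptR
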